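/- Let $\mathcal K=\mathcal K_1\sqcup\mathcal K_2$ be a finite nonempty set of base-station (BS) tiers in $\mathbb R^2$, with transmit powers $P_k>0$ and path-loss exponent $\alpha>2$; put $\bar P_{j,i}=(P_j/P_i)^{1/\alpha}$. For $k\in\mathcal K_2$, the BSs of tier $k$ form a homogeneous Poisson point process (PPP) $\Phi_k$ of intensity $\lambda_k>0$. For $k\in\mathcal K_1$, they form a Poisson cluster process $\Phi_k=\bigcup_{\mathbf z\in\Phi_{\mathrm p_k}}(\mathbf z+\mathcal B_k^{\mathbf z})$, where, given the parent point process $\Phi_{\mathrm p_k}$, the clusters $\mathcal B_k^{\mathbf z}$ are independent, each consisting of a $\mathrm{Poisson}(\bar m_k)$ number ($\bar m_k>0$) of i.i.d. points with probability density $g_k$ on $\mathbb R^2$. The parent process $\Phi_{\mathrm p_k}$ is a homogeneous PPP of intensity $\lambda_{\mathrm p_k}>0$, except that for users coupled to a tier $q\in\mathcal K_1$ one random point $\mathbf z_0$ (the centre of the typical user's cluster, of arbitrary law, independent of everything else) is added to the PPP to form $\Phi_{\mathrm p_q}$. Both uncoupled and coupled users are covered. All tiers are independent. For $k\in\mathcal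 K_1$ and $\mathbf z\in\mathbb R^2$, let $f_{\mathrm d_k}(\cdot\,|\,\mathbf z)$ and $F_{\mathrm d_k}(\cdot\,|\,\mathbf z)$ be the density and the distribution function of $\|\mathbf x\|$ when $\mathbf x$ has density $g_k(\cdot-\mathbf z)$. The typical user is at the origin. Let $\widetilde{\mathbf x}_k$ be the point of $\Phi_k$ nearest to the origin, let the serving BS $\mathbf x^*$ be the $\widetilde{\mathbf x}_k$ that maximizes $P_k\|\widetilde{\mathbf x}_k\|^{-\alpha}$ over $k\in\mathcal K$, and let $\mathcal S_i=\{\mathbf x^*=\widetilde{\mathbf x}_i\}$. Let $\mathcal G$ be the $\sigma$-algebra generated by the parent processes $\Phi_{\mathrm p_k}$, $k\in\mathcal K_1$. For $i\in\mathcal K$ and $r\ge 0$ set $$V_i(r)=\prod_{j_1\in\mathcal K_1}\ \prod_{\mathbf z\in\Phi_{\mathrm p_{j_1}}}\exp\!\big(-\bar m_{j_1}F_{\mathrm d_{j_1}}(\bar P_{j_1,i}\,r\,|\,\mathbf z)\big)\ \prod_{j_2\in\mathcal K_2}\exp\!\big(-\pi\lambda_{j_2}\bar P_{j_2,i}^2r^2\big),$$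 $$h_i(r)=\begin{cases}\displaystyle \bar m_i\sum_{\mathbf z\in\Phi_{\mathrm p_i}}f_{\mathrm d_i}(r\,|\,\mathbf z)\;V_i(r), & i\in\mathcal K_1,\\[2mm] 2\pi\lambda_i\, r\,V_i(r), & i\in\mathcal K_2.\end{cases}$$ Then for every $i\in\mathcal K$, almost surely, $\mathbb P(\mathcal S_i\,|\,\mathcal G)=\int_0^\infty h_i(r)\,dr>0$, and the conditional distribution of $\|\mathbf x^*\|$ given $\mathcal S_i$ and the parent processes is concentrated on $[0,\infty)$ with density $$f_{s_i}(r\,|\,\mathcal S_i,\ \Phi_{\mathrm p_k}\ \forall k\in\mathcal K_1)=\frac{h_i(r)}{\mathbb P(\mathcal S_i\,|\,\mathcal G)},\qquad r\ge 0 .$$ -/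

import Mathlib

open MeasureTheory ProbabilityTheory
open scoped ENNReal NNReal

noncomputable section

namespace HetNet

/-- The Euclidean plane, in which all base stations (BSs) live; the typical user is at the origin. -/
abbrev Plane : Type := EuclideanSpace ℝ (Fin 2)

/-- The counting measure of the points `X n ω`, `n : ι` (with multiplicity). -/
def pointMeasure {ι Ω : Type*} (X : ι → Ω → Plane) (ω : Ω) : Measure Plane :=
  Measure.sum fun n => Measure.dirac (X n ω)

/-- The points `X 0, X 1, …` form a homogeneous Poisson point process of intensity `lam` on the
plane: the number of points in a Borel set `A` of finite area `|A|` is Poisson with mean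
`lam * |A|`, and the numbers of points in disjoint Borel sets are independent.
(For `lam > 0` such a process almost surely has infinitely many points, so that its points are
enumerated by `ℕ`.) -/
structure IsPPP {Ω : Type*} [MeasurableSpace Ω] (X : ℕ → Ω → Plane) (lam : ℝ)
    (μ : Measure Ω) : Prop where
  measurable : ∀ n, Measurable (X n)
  law : ∀ A : Set Plane, MeasurableSet A → volume A ≠ ∞ →
    μ.map (fun ω => pointMeasure X ω A)
      = (poissonMeasure (Real.toNNReal (lam * volume.real A))).map (fun n : ℕ => (n : ℝ≥0∞))
  indep : ∀ (m : ℕ) (A : Fin m → Set Plane), (∀ a, MeasurableSet (A a)) →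
    Pairwise (fun a b => Disjoint (A a) (A b)) →
    iIndepFun (fun a ω => pointMeasure X ω (A a)) μ

/-- Law of the distance from the origin of an offspring point whose cluster centre is `z`: the
point has density `f(x | z) = g (x - z)`. -/
def distLaw (g : Plane → ℝ) (z : Plane) : Measure ℝ :=
  (volume.withDensity fun x => ENNReal.ofReal (g (x - z))).map fun x => ‖x‖

/-- The density `f_d(r | z)` of that distance. -/
def distPDF (g : Plane → ℝ) (r : ℝ) (z : Plane) : ℝ≥0∞ :=
  (distLaw g z).rnDeriv volume r

/-- The distribution function `F_d(r | z)` of that distance. -/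
def distCDF (g : Plane → ℝ) (r : ℝ) (z : Plane) : ℝ :=
  (distLaw g z).real (Set.Iic r)

/-- Deterministic parameters of the network: the tiers in `K₁` are Poisson cluster processes, those
in `K₂` are Poisson point processes. -/
structure Params (K₁ K₂ : Type*) where
  /-- intensity of the parent process of a clustered tier -/
  lamP : K₁ → ℝ
  /-- offspring density, relative to the cluster centre, of a clustered tier -/
  g : K₁ → Plane → ℝ
  /-- mean number of points per cluster of a clustered tier -/
  mbar : K₁ → ℝ
  /-- intensity of a Poisson tier -/
  lam : K₂ → ℝ
  /-- transmit power of a BS of a tier -/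
  P : K₁ ⊕ K₂ → ℝ
  /-- path-loss exponent -/
  α : ℝ
  lamP_pos : ∀ k, 0 < lamP k
  g_measurable : ∀ k, Measurable (g k)
  g_nonneg : ∀ k x, 0 ≤ g k x
  g_lintegral : ∀ k, ∫⁻ x, ENNReal.ofReal (g k x) = 1
  mbar_pos : ∀ k, 0 < mbar k
  lam_pos : ∀ k, 0 < lam k
  P_pos : ∀ k, 0 < P k
  two_lt_α : 2 < α

/-- `P̄_{j,i} = (P_j / P_i)^{1/α}`. -/
def Params.Pbar {K₁ K₂ : Type*} (p : Params K₁ K₂) (j i : K₁ ⊕ K₂) : ℝ :=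
  (p.P j / p.P i) ^ (1 / p.α)

/-- The random objects from which the network is built. The clusters of a clustered tier are
indexed by `Option ℕ`: cluster `some n` is centred at the `n`-th point of the parent Poisson
process, and cluster `none` is the representative cluster, centred at `z₀`; the latter is present
only in the tier that is coupled to the users. -/
structure Data (K₁ K₂ Ω : Type*) where
  /-- the points of the parent Poisson process of a clustered tier -/
  parent : K₁ → ℕ → Ω → Plane
  /-- the centre of the cluster to which the typical user belongs -/
  z₀ : Ω → Plane
  /-- number of points of a cluster -/
  size : K₁ → Option ℕ → Ω → ℕ
  /-- positions of the offspring points of a cluster relative to its centre -/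
  offset : K₁ → Option ℕ → ℕ → Ω → Plane
  /-- the points of a Poisson tier -/
  station : K₂ → ℕ → Ω → Plane

/-- Labels of the independent sources of randomness. -/
inductive Source (K₁ K₂ : Type*)
  | parent (k : K₁)
  | center
  | size (k : K₁) (n : Option ℕ)
  | offset (k : K₁) (n : Option ℕ) (l : ℕ)
  | station (k : K₂)

namespace Data

variable {K₁ K₂ Ω : Type*} (D : Data K₁ K₂ Ω)

/-- The σ-algebra generated by one source of randomness. -/
abbrev sigma : Source K₁ K₂ → MeasurableSpace Ω
  | .parent k => MeasurableSpace.comap (fun ω n => D.parent k n ω) inferInstance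
  | .center => MeasurableSpace.comap D.z₀ inferInstance
  | .size k n => MeasurableSpace.comap (D.size k n) inferInstance
  | .offset k n l => MeasurableSpace.comap (D.offset k n l) inferInstance
  | .station k => MeasurableSpace.comap (fun ω n => D.station k n ω) inferInstance

/-- Indices of the clusters that are present in tier `k`. Here `q = none` stands for users that are
not coupled to the BSs, and `q = some k` for users coupled to the clustered tier `k`. -/
abbrev ClusterIndex (q : Option K₁) (k : K₁) : Type :=
  {n : Option ℕ // n = none → q = some k}

/-- Centre of a cluster of tier `k`. -/
def center (k : K₁) : Option ℕ → Ω → Plane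
  | some n => D.parent k n
  | none => D.z₀

/-- The parent point process of tier `k`, as a random counting measure; it includes `z₀` when the
users are coupled to tier `k`. -/
def parentPP (q : Option K₁) (ω : Ω) (k : K₁) : Measure Plane :=
  pointMeasure (fun n : ClusterIndex q k => D.center k n.1) ω

/-- The σ-algebra generated by all parent point processes. -/
abbrev parentSigma (q : Option K₁) : MeasurableSpace Ω :=
  MeasurableSpace.comap (D.parentPP q) inferInstance

/-- The set of BSs of a tier: all points of all clusters for a tier in `K₁`. -/
def stations (q : Option K₁) (ω : Ω) : K₁ ⊕ K₂ → Set Plane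
  | .inl k => {x | ∃ (n : ClusterIndex q k) (l : ℕ),
      l < D.size k n.1 ω ∧ x = D.center k n.1 ω + D.offset k n.1 l ω}
  | .inr k => {x | ∃ n : ℕ, x = D.station k n ω}

end Data

open Classical in
/-- The point of `S` that is nearest to the origin (`0` if there is none). -/
def nearest (S : Set Plane) : Plane :=
  if h : ∃ x ∈ S, ∀ y ∈ S, ‖x‖ ≤ ‖y‖ then h.choose else 0

/-- The network model: the data have the prescribed laws and are mutually independent. The law of
`z₀` is arbitrary. -/
structure IsModel {K₁ K₂ Ω : Type*} [MeasurableSpace Ω] (p : Params K₁ K₂)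
    (D : Data K₁ K₂ Ω) (μ : Measure Ω) : Prop where
  parent_ppp : ∀ k, IsPPP (D.parent k) (p.lamP k) μ
  z₀_measurable : Measurable D.z₀
  size_measurable : ∀ k n, Measurable (D.size k n)
  size_law : ∀ k n, μ.map (D.size k n) = poissonMeasure (Real.toNNReal (p.mbar k))
  offset_measurable : ∀ k n l, Measurable (D.offset k n l)
  offset_law : ∀ k n l,
    μ.map (D.offset k n l) = volume.withDensity fun x => ENNReal.ofReal (p.g k x)
  station_ppp : ∀ k, IsPPP (D.station k) (p.lam k) μ
  indep : iIndep D.sigma μ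

section Association

variable {K₁ K₂ Ω : Type*} [Fintype K₁] [Fintype K₂] [Nonempty (K₁ ⊕ K₂)]
  (p : Params K₁ K₂) (q : Option K₁) (D : Data K₁ K₂ Ω)

/-- Location of the candidate serving BS of tier `k`: the BS of the tier nearest to the user. -/
def candidate (k : K₁ ⊕ K₂) (ω : Ω) : Plane :=
  nearest (D.stations q ω k)

/-- Power received from the candidate serving BS of tier `k`, averaged over fading. -/
def candidatePower (k : K₁ ⊕ K₂) (ω : Ω) : ℝ :=
  p.P k * ‖candidate q D k ω‖ ^ (-p.α)

/-- A tier whose candidate serving BS provides the largest average received power. -/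
def servingTier (ω : Ω) : K₁ ⊕ K₂ :=
  (Finite.exists_max fun k => candidatePower p q D k ω).choose

/-- Location of the serving BS. -/
def serving (ω : Ω) : Plane :=
  candidate q D (servingTier p q D ω) ω

/-- The association event of tier `i`: the serving BS is the candidate BS of tier `i`. -/
def assoc (i : K₁ ⊕ K₂) : Set Ω :=
  {ω | serving p q D ω = candidate q D i ω}

end Association

section Formula

variable {K₁ K₂ Ω : Type*} [Fintype K₁] [Fintype K₂]
  (p : Params K₁ K₂) (q : Option K₁) (D : Data K₁ K₂ Ω)

/-- The product
`∏_{j₁ ∈ K₁} ∏_{z ∈ Φ_{p,j₁}} exp (-m̄_{j₁} F_{d,j₁}(P̄_{j₁,i} r | z)) *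
  ∏_{j₂ ∈ K₂} exp (-π λ_{j₂} P̄_{j₂,i}² r²)`. -/
def voidFactor (i : K₁ ⊕ K₂) (ω : Ω) (r : ℝ) : ℝ :=
  (∏ j₁ : K₁, ∏' n : Data.ClusterIndex q j₁,
    Real.exp (-(p.mbar j₁ * distCDF (p.g j₁) (p.Pbar (.inl j₁) i * r) (D.center j₁ n.1 ω)))) *
  ∏ j₂ : K₂, Real.exp (-(Real.pi * p.lam j₂ * p.Pbar (.inr j₂) i ^ 2 * r ^ 2))

/-- The integrand of the conditional association probability of tier `i`: for `i ∈ K₁` it is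
`m̄_i ∑_{z ∈ Φ_{p,i}} f_{d,i}(r | z)` times the above product, and for `i ∈ K₂` it is `2 π λ_i r`
times the above product. -/
def assocIntegrand (i : K₁ ⊕ K₂) (ω : Ω) (r : ℝ) : ℝ≥0∞ :=
  match i with
  | .inl k => ENNReal.ofReal (p.mbar k) *
      (∑' n : Data.ClusterIndex q k, distPDF (p.g k) r (D.center k n.1 ω)) *
      ENNReal.ofReal (voidFactor p q D (.inl k) ω r)
  | .inr k => ENNReal.ofReal (2 * Real.pi * p.lam k * voidFactor p q D (.inr k) ω r * r)

end Formula

end HetNet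

end

/-! Freeze the cluster centres. The remaining randomness (cluster sizes, offsets, stations of the
Poisson tiers) is independent of the centres by `IsModel.indepFun_centers_marks`, and the distances
$R_k$ from the origin to the tiers become independent, since they use disjoint sources. Each
satisfies $P(R_k\ge r)=e^{-\Lambda_k(r)}$ (`IsModel.measure_radius`). For a Poisson tier this is the
void probability. For a clustered tier it is a product over clusters: averaging $(1-F)^N$ over a
Poisson size $N$ gives $e^{-\bar m F}$. As $\Lambda_k$ is the integral of a hazard rate $\ell_k$,
the distance $R_k$ has density $\ell_k e^{-\Lambda_k}$.

Comparing powers amounts to comparing distances: up to null events, tier $i$ serves exactly when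
$\bar P_{j,i}R_i\le R_j$ for all $j\ne i$. Conditioning on $R_i=r$ and multiplying survival
functions gives the density $\ell_i(r)\prod_j e^{-\Lambda_j(\bar P_{j,i}r)}$, in which the factor
$j=i$ comes from the density of $R_i$. This is `assocDensity`, which agrees almost everywhere with
the stated integrand (`assocIntegrand_ae_eq`). Integrating over the centres gives the joint law
`IsModel.measure_parentPP_inter`, from which both the conditional probability and the conditional
law are read off.

Three points need care. The conditioning is on counting measures, not on enumerated points, so
hazards are built as measurable functions of the measure (`exists_measurable_lintegral`). Local
finiteness and convergence of the sums, collected in `Good`, hold almost surely by Campbell's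
formula (`IsModel.ae_good`). Finally, the total hazard of every tier is infinite
(`Good.lintegral_hazard_eq_top`): this makes every tier nonempty and the association probability
positive. -/

namespace HetNet

/-! ### Independent blocks, absolute continuity, and hazard rates -/

section Generic

open Set Filter Topology

/-- Blocks of independent σ-algebras over pairwise disjoint index sets are independent. -/
theorem iIndep_biSup {Ω ι κ : Type*} {mΩ : MeasurableSpace Ω} {μ : Measure Ω}
    [IsProbabilityMeasure μ] {m : ι → MeasurableSpace Ω} (hm : ∀ i, m i ≤ mΩ) (h : iIndep m μ)
    (S : κ → Set ι) (hS : Pairwise fun a b => Disjoint (S a) (S b)) :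
    iIndep (fun k => ⨆ i ∈ S k, m i) μ := by
  classical
  rw [iIndep_iff]
  intro s f hf
  induction s using Finset.induction_on with
  | empty => simp
  | insert a s ha ih =>
    rw [Finset.set_biInter_insert, Finset.prod_insert ha,
      ← ih fun k hk => hf k (Finset.mem_insert_of_mem hk)]
    have hd : Disjoint (S a) (⋃ k ∈ s, S k) := by
      simp only [Set.disjoint_iUnion_right]
      intro k hk
      exact hS (by rintro rfl; exact ha hk)
    refine (Indep_iff _ _ _).1 (indep_iSup_of_disjoint hm h hd) _ _
      (hf a (Finset.mem_insert_self _ _)) ?_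
    refine Finset.measurableSet_biInter _ fun k hk => ?_
    have hle : (⨆ i ∈ S k, m i) ≤ ⨆ i ∈ ⋃ k ∈ s, S k, m i :=
      biSup_mono fun i hi => Set.mem_biUnion hk hi
    exact hle _ (hf k (Finset.mem_insert_of_mem hk))

/-- The probability that countably many independent events occur simultaneously, when their
probabilities are exponentials. -/
theorem measure_iInter_of_iIndepSet {Ω ι : Type*} {mΩ : MeasurableSpace Ω} {μ : Measure Ω}
    [IsProbabilityMeasure μ] [Countable ι] {A : ι → Set Ω} (hA : ∀ n, MeasurableSet (A n))
    (h : iIndepSet A μ) {a : ι → ℝ} (ha : ∀ n, μ (A n) = ENNReal.ofReal (Real.exp (-a n)))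
    (hs : Summable a) :
    μ (⋂ n, A n) = ENNReal.ofReal (Real.exp (-∑' n, a n)) := by
  classical
  have h1 : ∀ s : Finset ι, μ (⋂ n ∈ s, A n) = ENNReal.ofReal (Real.exp (-∑ n ∈ s, a n)) := by
    intro s
    rw [(iIndepSet_iff_meas_biInter hA).1 h s, Finset.prod_congr rfl fun n _ => ha n,
      ← ENNReal.ofReal_prod_of_nonneg fun _ _ => (Real.exp_pos _).le, ← Real.exp_sum,
      Finset.sum_neg_distrib]
  have h2 : Tendsto (fun s : Finset ι => μ (⋂ n ∈ s, A n)) atTop (𝓝 (μ (⋂ n, A n))) := by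
    have := tendsto_measure_iInter_atTop (μ := μ) (s := fun s : Finset ι => ⋂ n ∈ s, A n)
      (fun s => (Finset.measurableSet_biInter _ fun n _ => hA n).nullMeasurableSet)
      (fun s t hst => Set.biInter_mono hst fun _ _ => le_rfl) ⟨∅, measure_ne_top _ _⟩
    have hI : ⋂ s : Finset ι, ⋂ n ∈ s, A n = ⋂ n, A n := by
      ext ω
      simp only [Set.mem_iInter]
      exact ⟨fun hω n => hω {n} n (Finset.mem_singleton_self n), fun hω _ n _ => hω n⟩
    rwa [hI] at this
  refine tendsto_nhds_unique h2 ?_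
  simp_rw [h1]
  exact (ENNReal.continuous_ofReal.tendsto _).comp
    ((Real.continuous_exp.tendsto _).comp (Tendsto.neg hs.hasSum))

/-- A Lipschitz function of an absolutely continuous function is absolutely continuous. -/
theorem _root_.LipschitzOnWith.comp_absolutelyContinuousOnInterval {f g : ℝ → ℝ} {K : ℝ≥0}
    {s : Set ℝ} {a b : ℝ} (hg : LipschitzOnWith K g s) (hf : AbsolutelyContinuousOnInterval f a b)
    (hfs : MapsTo f (uIcc a b) s) : AbsolutelyContinuousOnInterval (fun x => g (f x)) a b := by
  rw [absolutelyContinuousOnInterval_iff] at hf ⊢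
  intro ε hε
  -- The `+ 1` keeps the divisor positive when $K=0$ and makes the final inequality strict.
  obtain ⟨δ, hδ, h⟩ := hf (ε / (K + 1)) (by positivity)
  refine ⟨δ, hδ, fun E hE hE' => ?_⟩
  have h1 := h E hE hE'
  calc ∑ i ∈ Finset.range E.1, dist (g (f (E.2 i).1)) (g (f (E.2 i).2))
      ≤ ∑ i ∈ Finset.range E.1, K * dist (f (E.2 i).1) (f (E.2 i).2) :=
        Finset.sum_le_sum fun i hi => hg.dist_le_mul _ (hfs (hE.1 i hi).1) _ (hfs (hE.1 i hi).2)
    _ = K * ∑ i ∈ Finset.range E.1, dist (f (E.2 i).1) (f (E.2 i).2) := by rw [Finset.mul_sum]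
    _ ≤ K * (ε / (K + 1)) := by gcongr
    _ < (K + 1) * (ε / (K + 1)) := by gcongr; linarith
    _ = ε := by field_simp

theorem lipschitzOnWith_exp_neg : LipschitzOnWith 1 (fun x : ℝ => Real.exp (-x)) (Ici 0) := by
  refine Convex.lipschitzOnWith_of_nnnorm_hasDerivWithin_le (convex_Ici 0)
    (f' := fun x => -Real.exp (-x)) (fun x _ => ?_) fun x hx => ?_
  · simpa using ((hasDerivAt_neg x).exp).hasDerivWithinAt
  · rw [← NNReal.coe_le_coe]
    simpa using hx

/-- A hazard rate integrated against the survival function it generates. -/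
theorem lintegral_Ico_mul_exp_neg {l : ℝ → ℝ≥0∞} (hl : Measurable l)
    (hfin : ∀ r, ∫⁻ s in Icc 0 r, l s ≠ ∞) {a b : ℝ} (ha : 0 ≤ a) (hab : a ≤ b) :
    ∫⁻ r in Ico a b, l r * ENNReal.ofReal (Real.exp (-(∫⁻ s in Icc 0 r, l s).toReal))
      = ENNReal.ofReal (Real.exp (-(∫⁻ s in Icc 0 a, l s).toReal)
          - Real.exp (-(∫⁻ s in Icc 0 b, l s).toReal)) := by
  set u : ℝ → ℝ := fun s => (l s).toReal
  have hae : ∀ r, ∀ᵐ s ∂volume.restrict (Icc 0 r), l s < ∞ := fun r =>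
    ae_lt_top hl (hfin r)
  have hint : ∀ r, IntegrableOn u (Icc 0 r) := fun r =>
    integrable_toReal_of_lintegral_ne_top hl.aemeasurable (hfin r)
  have hL : ∀ r, 0 ≤ r → (∫⁻ s in Icc 0 r, l s).toReal = ∫ s in (0:ℝ)..r, u s := by
    intro r hr
    rw [intervalIntegral.integral_of_le hr, ← integral_Icc_eq_integral_Ioc,
      integral_toReal hl.aemeasurable (hae r)]
  set G : ℝ → ℝ := fun r => ∫ s in (0:ℝ)..r, u s
  have hb : 0 ≤ b := ha.trans hab
  have hii : IntervalIntegrable u volume 0 b := by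
    rw [intervalIntegrable_iff_integrableOn_Icc_of_le hb]; exact hint b
  -- The rate is only locally integrable, so $e^{-G}$ need not be differentiable everywhere.
  -- Absolute continuity lets the fundamental theorem of calculus run with the almost everywhere
  -- derivative.
  have hGac : AbsolutelyContinuousOnInterval G a b :=
    (hii.absolutelyContinuousOnInterval_intervalIntegral (c := 0) (by simp)).mono (by
      rw [uIcc_of_le hab, uIcc_of_le hb]; exact Icc_subset_Icc_left ha)
  have hmaps : MapsTo G (uIcc a b) (Ici 0) := by
    intro x hx
    rw [uIcc_of_le hab] at hx
    exact intervalIntegral.integral_nonneg (ha.trans hx.1) fun s _ => ENNReal.toReal_nonneg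
  have hE := lipschitzOnWith_exp_neg.comp_absolutelyContinuousOnInterval hGac hmaps
  have hftc := hE.integral_deriv_eq_sub
  have hcongr : ∀ᵐ x, x ∈ uIcc a b →
      deriv (fun x => Real.exp (-G x)) x = -(u x * Real.exp (-G x)) := by
    filter_upwards [hii.ae_hasDerivAt_integral] with x hx hxab
    have hx0 : x ∈ uIcc 0 b := by
      rw [uIcc_of_le hab] at hxab; rw [uIcc_of_le hb]; exact ⟨ha.trans hxab.1, hxab.2⟩
    have h1 : HasDerivAt (fun x => -G x) (-u x) x := (hx hx0 0 (by simp)).neg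
    rw [h1.exp.deriv]; ring
  have hcont : ContinuousOn (fun x => Real.exp (-G x)) (Icc a b) := by
    rw [← uIcc_of_le hab]; exact hE.continuousOn
  have hintE : IntegrableOn (fun x => u x * Real.exp (-G x)) (Icc a b) :=
    ((hint b).mono_set (Icc_subset_Icc_left ha)).mul_continuousOn hcont isCompact_Icc
  have hval : ∫ x in Icc a b, u x * Real.exp (-G x) = Real.exp (-G a) - Real.exp (-G b) := by
    rw [integral_Icc_eq_integral_Ioc, ← intervalIntegral.integral_of_le hab]
    have : ∫ x in a..b, deriv (fun x => Real.exp (-G x)) x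
        = ∫ x in a..b, -(u x * Real.exp (-G x)) := by
      refine intervalIntegral.integral_congr_ae ?_
      filter_upwards [hcongr] with x hx hxab using hx (uIoc_subset_uIcc hxab)
    rw [intervalIntegral.integral_neg, hftc] at this
    linarith
  rw [hL a ha, hL b hb, ← hval,
    ofReal_integral_eq_lintegral_ofReal hintE (Eventually.of_forall fun x => by positivity),
    setLIntegral_congr (Ico_ae_eq_Icc (a := a) (b := b))]
  refine setLIntegral_congr_fun_ae measurableSet_Icc ?_
  have h3 := (ae_restrict_iff' measurableSet_Icc).1 (hae b)
  filter_upwards [h3] with x hx hxab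
  have hx0 : 0 ≤ x := ha.trans hxab.1
  rw [hL x hx0, ENNReal.ofReal_mul ENNReal.toReal_nonneg,
    ENNReal.ofReal_toReal (hx ⟨hx0, hxab.2⟩).ne]

/-- The domain of integration moves with the parameter; an indicator turns this into an integral
over a fixed domain. -/
theorem measurable_lintegral_Icc {X : Type*} [MeasurableSpace X] {l : X × ℝ → ℝ≥0∞}
    (hl : Measurable l) : Measurable fun p : X × ℝ => ∫⁻ s in Icc 0 p.2, l (p.1, s) := by
  have h : (fun p : X × ℝ => ∫⁻ s in Icc 0 p.2, l (p.1, s))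
      = fun p : X × ℝ => ∫⁻ s, {q : (X × ℝ) × ℝ | q.2 ∈ Icc 0 q.1.2}.indicator
          (fun q => l (q.1.1, q.2)) (p, s) := by
    funext p
    rw [← lintegral_indicator measurableSet_Icc]
    rfl
  rw [h]
  refine Measurable.lintegral_prod_right' (Measurable.indicator (by fun_prop) ?_)
  simp only [mem_Icc]
  measurability

/-- A nonnegative random variable with survival function `exp (-∫₀ʳ l)` has density
`l r * exp (-∫₀ʳ l)` on the half-line. -/
theorem map_eq_withDensity_of_survival {Ω : Type*} {mΩ : MeasurableSpace Ω} {μ : Measure Ω}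
    [IsProbabilityMeasure μ] {l : ℝ → ℝ≥0∞} (hl : Measurable l)
    (hfin : ∀ r, ∫⁻ s in Icc 0 r, l s ≠ ∞) {T : Ω → ℝ} (hT : Measurable T) (hT0 : ∀ ω, 0 ≤ T ω)
    (hsurv : ∀ r, 0 ≤ r →
      μ {ω | r ≤ T ω} = ENNReal.ofReal (Real.exp (-(∫⁻ s in Icc 0 r, l s).toReal))) :
    μ.map T = (volume.restrict (Ici 0)).withDensity fun r =>
      l r * ENNReal.ofReal (Real.exp (-(∫⁻ s in Icc 0 r, l s).toReal)) := by
  have := Measure.isProbabilityMeasure_map (μ := μ) hT.aemeasurable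
  -- Intervals $[a,b)$ suit survival events with $\le$: their preimages are differences of two such
  -- events.
  refine Measure.ext_of_Ico _ _ fun a b hab => ?_
  rw [Measure.map_apply hT measurableSet_Ico, withDensity_apply _ measurableSet_Ico,
    Measure.restrict_restrict measurableSet_Ico]
  have hI : Ico a b ∩ Ici 0 = Ico (max a 0) b := by
    ext x; simp only [mem_inter_iff, mem_Ico, mem_Ici, max_le_iff]; tauto
  rw [hI]
  rcases le_or_gt b 0 with hb | hb
  · rw [Ico_eq_empty_of_le (hb.trans (le_max_right a 0))]
    have : T ⁻¹' Ico a b = ∅ := by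
      ext ω
      simp only [mem_preimage, mem_Ico, mem_empty_iff_false, iff_false, not_and, not_lt]
      exact fun _ => hb.trans (hT0 ω)
    simp [this]
  · rw [lintegral_Ico_mul_exp_neg hl hfin (le_max_right a 0) (max_le hab.le hb.le)]
    have hset : T ⁻¹' Ico a b = {ω | max a 0 ≤ T ω} \ {ω | b ≤ T ω} := by
      ext ω
      simp only [mem_preimage, mem_Ico, Set.mem_sdiff, mem_ofPred_eq, not_le, max_le_iff, hT0 ω,
        and_true]
    have hsub : {ω | b ≤ T ω} ⊆ {ω | max a 0 ≤ T ω} := fun ω hω =>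
      (max_le hab.le hb.le).trans hω
    rw [hset, measure_sdiff hsub
      (measurableSet_le measurable_const hT).nullMeasurableSet (measure_ne_top _ _),
      hsurv _ (le_max_right a 0), hsurv b hb.le, ENNReal.ofReal_sub _ (Real.exp_pos _).le]

/-- A random variable with infinite total hazard is almost surely finite. -/
theorem measure_forall_le_eq_zero_of_survival {Ω : Type*} {mΩ : MeasurableSpace Ω}
    {μ : Measure Ω} {l : ℝ → ℝ≥0∞} (hfin : ∀ r, ∫⁻ s in Icc 0 r, l s ≠ ∞)
    (htot : ∫⁻ s in Ici 0, l s = ∞) {T : Ω → ℝ≥0∞}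
    (hsurv : ∀ r, 0 ≤ r → μ {ω | ENNReal.ofReal r ≤ T ω}
      = ENNReal.ofReal (Real.exp (-(∫⁻ s in Icc 0 r, l s).toReal))) :
    ∀ᵐ ω ∂μ, T ω ≠ ∞ := by
  -- Continuity from below, applied to the measure with density `l`.
  have h1 : Tendsto (fun n : ℕ => ∫⁻ s in Icc 0 (n : ℝ), l s) atTop (𝓝 ∞) := by
    have := tendsto_measure_iUnion_atTop (μ := volume.withDensity l)
      (s := fun n : ℕ => Icc 0 (n : ℝ))
      (fun m n hmn => Icc_subset_Icc_right (Nat.cast_le.2 hmn))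
    have hU : ⋃ n : ℕ, Icc 0 (n : ℝ) = Ici 0 := by
      ext x
      simp only [mem_iUnion, mem_Icc, mem_Ici]
      exact ⟨fun ⟨n, h⟩ => h.1, fun h => (exists_nat_ge x).imp fun n hn => ⟨h, hn⟩⟩
    rw [hU, withDensity_apply _ measurableSet_Ici, htot] at this
    simpa only [Function.comp_def, withDensity_apply _ measurableSet_Icc] using this
  have h2 : Tendsto (fun n : ℕ => (∫⁻ s in Icc 0 (n : ℝ), l s).toReal) atTop atTop := by
    rw [← ENNReal.tendsto_ofReal_nhds_top]
    simpa only [ENNReal.ofReal_toReal (hfin _)] using h1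
  have h3 : Tendsto (fun n : ℕ =>
      ENNReal.ofReal (Real.exp (-(∫⁻ s in Icc 0 (n : ℝ), l s).toReal))) atTop (𝓝 0) := by
    have := (ENNReal.continuous_ofReal.tendsto 0).comp
      (Real.tendsto_exp_neg_atTop_nhds_zero.comp h2)
    rwa [ENNReal.ofReal_zero] at this
  rw [ae_iff]
  refine le_antisymm (ge_of_tendsto' h3 fun n => ?_) bot_le
  rw [← hsurv n n.cast_nonneg]
  refine measure_mono fun ω hω => ?_
  simp only [ne_eq, not_not, mem_ofPred_eq] at hω ⊢
  rw [hω]; exact le_top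

end Generic

/-! ### The law of the distance of one offspring point -/

section Distance

open Set

theorem volume_setOf_norm_lt {r : ℝ} (hr : 0 ≤ r) :
    volume {x : Plane | ‖x‖ < r} = ENNReal.ofReal (Real.pi * r ^ 2) := by
  have h : {x : Plane | ‖x‖ < r} = Metric.ball 0 r := by ext; simp
  rw [h, EuclideanSpace.volume_ball_fin_two, mul_comm, ENNReal.ofReal_mul Real.pi_pos.le,
    ENNReal.ofReal_pow hr]

theorem volume_setOf_norm_le {r : ℝ} (hr : 0 ≤ r) :
    volume {x : Plane | ‖x‖ ≤ r} = ENNReal.ofReal (Real.pi * r ^ 2) := by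
  have h : {x : Plane | ‖x‖ ≤ r} = Metric.closedBall 0 r := by ext; simp
  rw [h, EuclideanSpace.volume_closedBall_fin_two, mul_comm, ENNReal.ofReal_mul Real.pi_pos.le,
    ENNReal.ofReal_pow hr]

theorem lintegral_Icc_linear {c : ℝ} (hc : 0 ≤ c) {r : ℝ} (hr : 0 ≤ r) :
    ∫⁻ s in Icc 0 r, ENNReal.ofReal (2 * c * s) = ENNReal.ofReal (c * r ^ 2) := by
  rw [← ofReal_integral_eq_lintegral_ofReal]
  · congr 1
    rw [integral_Icc_eq_integral_Ioc, ← intervalIntegral.integral_of_le hr,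
      intervalIntegral.integral_const_mul, integral_id]
    ring
  · exact (by fun_prop : Continuous fun s : ℝ => 2 * c * s).integrableOn_Icc
  · filter_upwards [ae_restrict_mem measurableSet_Icc] with s hs
    have := hs.1
    positivity

/-- Polar coordinates, checked on annuli through areas of disks. Hence the norm carries absolutely
continuous laws on the plane to absolutely continuous laws on the line. -/
theorem map_norm_volume : (volume : Measure Plane).map (fun x => ‖x‖)
    = (volume.restrict (Ici 0)).withDensity fun r => ENNReal.ofReal (2 * Real.pi * r) := by
  refine Measure.ext_of_Ico' _ _ (fun a b hab => ?_) fun a b hab => ?_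
  · rw [Measure.map_apply measurable_norm measurableSet_Ico]
    refine ne_top_of_le_ne_top ?_ (measure_mono (t := {x : Plane | ‖x‖ ≤ max b 0}) fun x hx =>
      hx.2.le.trans (le_max_left b 0))
    rw [volume_setOf_norm_le (le_max_right b 0)]
    exact ENNReal.ofReal_ne_top
  rw [Measure.map_apply measurable_norm measurableSet_Ico, withDensity_apply _ measurableSet_Ico,
    Measure.restrict_restrict measurableSet_Ico]
  have hI : Ico a b ∩ Ici 0 = Ico (max a 0) b := by
    ext x; simp only [mem_inter_iff, mem_Ico, mem_Ici, max_le_iff]; tauto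
  rw [hI]
  rcases le_or_gt b 0 with hb | hb
  · rw [Ico_eq_empty_of_le (hb.trans (le_max_right a 0))]
    have : (fun x : Plane => ‖x‖) ⁻¹' Ico a b = ∅ := by
      ext x
      simp only [mem_preimage, mem_Ico, mem_empty_iff_false, iff_false, not_and, not_lt]
      exact fun _ => hb.trans (norm_nonneg x)
    simp [this]
  · have hm0 : 0 ≤ max a 0 := le_max_right a 0
    have hmb : max a 0 ≤ b := max_le hab.le hb.le
    have hset : (fun x : Plane => ‖x‖) ⁻¹' Ico a b
        = {x : Plane | ‖x‖ < b} \ {x : Plane | ‖x‖ < max a 0} := by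
      ext x
      simp only [mem_preimage, mem_Ico, mem_sdiff, mem_ofPred_eq, not_lt, max_le_iff,
        norm_nonneg, and_true]
      tauto
    have hsub : {x : Plane | ‖x‖ < max a 0} ⊆ {x : Plane | ‖x‖ < b} := fun x hx =>
      lt_of_lt_of_le hx hmb
    have hm : MeasurableSet {x : Plane | ‖x‖ < max a 0} :=
      measurableSet_lt measurable_norm measurable_const
    rw [hset, measure_sdiff hsub hm.nullMeasurableSet
      (by rw [volume_setOf_norm_lt hm0]; exact ENNReal.ofReal_ne_top),
      volume_setOf_norm_lt hb.le, volume_setOf_norm_lt hm0,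
      ← lintegral_Icc_linear Real.pi_pos.le hb.le, ← lintegral_Icc_linear Real.pi_pos.le hm0]
    have hun : Icc 0 b = Icc 0 (max a 0) ∪ Ioc (max a 0) b := (Icc_union_Ioc_eq_Icc hm0 hmb).symm
    rw [hun, lintegral_union measurableSet_Ioc
      ((Set.disjoint_left).2 fun x hx hx' => not_le.2 hx'.1 hx.2), ENNReal.add_sub_cancel_left]
    · exact setLIntegral_congr Ico_ae_eq_Ioc.symm
    · rw [lintegral_Icc_linear Real.pi_pos.le hm0]; exact ENNReal.ofReal_ne_top

variable {g : Plane → ℝ}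

/-- The law of a random vector with density `g`. -/
noncomputable abbrev densityLaw (g : Plane → ℝ) : Measure Plane :=
  volume.withDensity fun x => ENNReal.ofReal (g x)

/-- By translation invariance the centre moves from the density into the map. This form is
measurable in $z$ and matches the model, where a point is a centre plus an offset. -/
theorem distLaw_eq_map (g : Plane → ℝ) (z : Plane) :
    distLaw g z = (densityLaw g).map fun x => ‖z + x‖ := by
  have h : (volume.withDensity fun x => ENNReal.ofReal (g (x - z)))
      = (densityLaw g).map fun x => z + x := by
    ext s hs
    rw [Measure.map_apply (measurable_const_add z) hs, withDensity_apply _ hs,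
      withDensity_apply _ (measurable_const_add z hs), ← lintegral_indicator hs,
      ← lintegral_indicator (measurable_const_add z hs),
      ← lintegral_add_left_eq_self _ z]
    congr 1 with x
    simp only [indicator, add_sub_cancel_left]
    rfl
  rw [distLaw, h, Measure.map_map measurable_norm (measurable_const_add z)]
  rfl

theorem distLaw_absolutelyContinuous (g : Plane → ℝ) (z : Plane) : distLaw g z ≪ volume := by
  refine ((withDensity_absolutelyContinuous _ _).map measurable_norm).trans ?_
  rw [map_norm_volume]
  exact (withDensity_absolutelyContinuous _ _).trans Measure.restrict_le_self.absolutelyContinuous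

theorem distLaw_Iio_zero (g : Plane → ℝ) (z : Plane) : distLaw g z (Iio 0) = 0 := by
  rw [distLaw, Measure.map_apply measurable_norm measurableSet_Iio]
  have : (fun x : Plane => ‖x‖) ⁻¹' Iio 0 = ∅ := by
    ext x; simp
  simp [this]

theorem isProbabilityMeasure_densityLaw (h1 : ∫⁻ x, ENNReal.ofReal (g x) = 1) :
    IsProbabilityMeasure (densityLaw g) := ⟨by simpa using h1⟩

theorem isProbabilityMeasure_distLaw (h1 : ∫⁻ x, ENNReal.ofReal (g x) = 1)
    (z : Plane) : IsProbabilityMeasure (distLaw g z) := by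
  have := isProbabilityMeasure_densityLaw h1
  rw [distLaw_eq_map g]
  exact Measure.isProbabilityMeasure_map (by fun_prop)

/-- The distance densities can be chosen jointly measurable in the centre and the distance. -/
theorem exists_measurable_distLaw_density (h1 : ∫⁻ x, ENNReal.ofReal (g x) = 1) :
    ∃ f : Plane × ℝ → ℝ≥0∞, Measurable f ∧
      ∀ z, distLaw g z = volume.withDensity fun r => f (z, r) := by
  have := isProbabilityMeasure_densityLaw h1
  have hprob := isProbabilityMeasure_distLaw h1
  have hmeas : Measurable (distLaw g) := by
    refine Measure.measurable_of_measurable_coe _ fun s hs => ?_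
    have h : ∀ z, distLaw g z s =
        densityLaw g (Prod.mk z ⁻¹' {p : Plane × Plane | ‖p.1 + p.2‖ ∈ s}) := by
      intro z
      rw [distLaw_eq_map g, Measure.map_apply (by fun_prop) hs]
      rfl
    simp_rw [h]
    exact measurable_measure_prodMk_left ((by fun_prop : Measurable fun p : Plane × Plane =>
      ‖p.1 + p.2‖) hs)
  let κ : Kernel Plane ℝ := ⟨distLaw g, hmeas⟩
  have hκ : IsMarkovKernel κ := ⟨fun z => hprob z⟩
  -- Lebesgue measure is replaced by an equivalent finite measure to serve as a finite reference
  -- kernel; its own density is multiplied back.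
  let η : Kernel Plane ℝ := Kernel.const Plane (volume : Measure ℝ).toFinite
  refine ⟨fun p => (volume : Measure ℝ).toFinite.rnDeriv volume p.2 * Kernel.rnDeriv κ η p.1 p.2,
    ?_, fun z => ?_⟩
  · exact ((Measure.measurable_rnDeriv _ _).comp measurable_snd).mul
      (Kernel.measurable_rnDeriv κ η)
  · have hac : κ z ≪ η z := (distLaw_absolutelyContinuous g z).trans
      (absolutelyContinuous_toFinite volume)
    have h2 := Kernel.withDensity_rnDeriv_eq hac
    rw [Kernel.withDensity_apply _ (Kernel.measurable_rnDeriv κ η)] at h2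
    have h3 : (volume : Measure ℝ).withDensity ((volume : Measure ℝ).toFinite.rnDeriv volume)
        = (volume : Measure ℝ).toFinite :=
      Measure.withDensity_rnDeriv_eq _ _ (toFinite_absolutelyContinuous volume)
    have h4 := withDensity_mul (volume : Measure ℝ) (Measure.measurable_rnDeriv
      (volume : Measure ℝ).toFinite volume) (Kernel.measurable_rnDeriv_right κ η z)
    rw [h3] at h4
    exact h2.symm.trans h4.symm

theorem distLaw_Iic (g : Plane → ℝ) (z : Plane) {f : ℝ → ℝ≥0∞}
    (hf : distLaw g z = volume.withDensity f) (r : ℝ) :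
    distLaw g z (Iic r) = ∫⁻ s in Icc 0 r, f s := by
  have h : Iic r = (Icc 0 r) ∪ (Iio 0 ∩ Iic r) := by
    ext x; simp only [mem_Iic, mem_union, mem_Icc, mem_inter_iff, mem_Iio]
    constructor
    · intro h; rcases le_or_gt 0 x with h' | h' <;> tauto
    · tauto
  have h0 : distLaw g z (Iio 0 ∩ Iic r) = 0 :=
    measure_mono_null inter_subset_left (distLaw_Iio_zero g z)
  rw [h, measure_congr (union_ae_eq_left_of_ae_eq_empty (ae_eq_empty.2 h0)), hf,
    withDensity_apply _ measurableSet_Icc]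

theorem distPDF_ae_eq (z : Plane) {f : ℝ → ℝ≥0∞} (hfm : Measurable f)
    (hf : distLaw g z = volume.withDensity f) : ∀ᵐ r, distPDF g r z = f r := by
  simp only [distPDF, hf]
  exact Measure.rnDeriv_withDensity _ hfm

theorem ofReal_distCDF (h1 : ∫⁻ x, ENNReal.ofReal (g x) = 1) (r : ℝ)
    (z : Plane) : ENNReal.ofReal (distCDF g r z) = distLaw g z (Iic r) := by
  have := isProbabilityMeasure_distLaw h1 z
  rw [distCDF, Measure.real, ENNReal.ofReal_toReal (measure_ne_top _ _)]

theorem distLaw_Iio (g : Plane → ℝ) (z : Plane) (r : ℝ) :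
    distLaw g z (Iio r) = distLaw g z (Iic r) :=
  measure_congr ((distLaw_absolutelyContinuous g z).ae_eq Iio_ae_eq_Iic)

/-- The distance distribution functions integrate over the centre to the area of a disk. -/
theorem lintegral_distLaw_Iic (h1 : ∫⁻ x, ENNReal.ofReal (g x) = 1) {r : ℝ}
    (hr : 0 ≤ r) : ∫⁻ z, distLaw g z (Iic r) = ENNReal.ofReal (Real.pi * r ^ 2) := by
  have := isProbabilityMeasure_densityLaw h1
  have hm : MeasurableSet {p : Plane × Plane | ‖p.1 + p.2‖ ≤ r} :=
    measurableSet_le (by fun_prop) measurable_const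
  calc ∫⁻ z, distLaw g z (Iic r)
      = ∫⁻ z, densityLaw g (Prod.mk z ⁻¹' {p : Plane × Plane | ‖p.1 + p.2‖ ≤ r}) := by
        congr 1 with z
        rw [distLaw_eq_map g, Measure.map_apply (by fun_prop) measurableSet_Iic]
        rfl
    _ = ((volume : Measure Plane).prod (densityLaw g)) {p : Plane × Plane | ‖p.1 + p.2‖ ≤ r} :=
        (Measure.prod_apply hm).symm
    -- After the exchange of integrals, the section over an offset $x$ is a translate of the disk,
    -- whose area does not depend on $x$.
    _ = ∫⁻ x, volume ((fun z => (z, x)) ⁻¹' {p : Plane × Plane | ‖p.1 + p.2‖ ≤ r})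
          ∂(densityLaw g) := Measure.prod_apply_symm hm
    _ = ∫⁻ x, ENNReal.ofReal (Real.pi * r ^ 2) ∂(densityLaw g) := by
        congr 1 with x
        rw [← volume_setOf_norm_le hr, ← measure_preimage_add_right volume x {y : Plane | ‖y‖ ≤ r}]
        rfl
    _ = ENNReal.ofReal (Real.pi * r ^ 2) := by simp

end Distance

/-! ### Intensity, local finiteness and void probability of a Poisson process -/

section Poisson

open Set

theorem lintegral_natCast_poissonMeasure (r : ℝ≥0) :
    ∫⁻ n : ℕ, (n : ℝ≥0∞) ∂(poissonMeasure r) = r := by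
  have h : ∀ n : ℕ, ENNReal.ofReal (Real.exp (-r) * r ^ (n + 1) / (n + 1).factorial)
      * ((n + 1 : ℕ) : ℝ≥0∞)
      = r * ENNReal.ofReal (Real.exp (-r) * r ^ n / n.factorial) := by
    intro n
    rw [← ENNReal.ofReal_natCast, ← ENNReal.ofReal_coe_nnreal, ← ENNReal.ofReal_mul (by positivity),
      ← ENNReal.ofReal_mul (by positivity)]
    congr 1
    rw [Nat.factorial_succ]
    push_cast
    field_simp
    ring
  rw [poissonMeasure, lintegral_sum_measure]
  simp only [lintegral_smul_measure, lintegral_dirac, smul_eq_mul]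
  rw [tsum_eq_zero_add' ENNReal.summable]
  simp only [h, ENNReal.tsum_mul_left]
  rw [← ENNReal.ofReal_tsum_of_nonneg (fun n => by positivity)
    (hasSum_one_poissonMeasure r).summable,
    (hasSum_one_poissonMeasure r).tsum_eq]
  simp

variable {Ω : Type*} [MeasurableSpace Ω] {μ : Measure Ω} {X : ℕ → Ω → Plane} {lam : ℝ}

theorem pointMeasure_apply {ι Ω : Type*} (X : ι → Ω → Plane) (ω : Ω) {A : Set Plane}
    (hA : MeasurableSet A) :
    pointMeasure X ω A = ∑' n, A.indicator 1 (X n ω) := by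
  simp [pointMeasure, Measure.sum_apply _ hA, Measure.dirac_apply' _ hA]

theorem lintegral_pointMeasure {ι Ω : Type*} (X : ι → Ω → Plane) (ω : Ω) {f : Plane → ℝ≥0∞}
    (hf : Measurable f) : ∫⁻ z, f z ∂(pointMeasure X ω) = ∑' n, f (X n ω) := by
  simp [pointMeasure, lintegral_sum_measure, lintegral_dirac' _ hf]

/-- The expected number of points in $A$, computed from the enumeration and from the Poisson mean.
The law is prescribed only for finite area, so the identity extends along an exhaustion of the
plane. -/
theorem IsPPP.sum_map (h : IsPPP X lam μ) :
    Measure.sum (fun n => μ.map (X n)) = ENNReal.ofReal lam • volume := by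
  have key : ∀ A : Set Plane, MeasurableSet A → volume A ≠ ∞ →
      Measure.sum (fun n => μ.map (X n)) A = ENNReal.ofReal lam * volume A := by
    intro A hA hfin
    have hpm : Measurable fun ω => pointMeasure X ω A := by
      simp_rw [pointMeasure_apply X _ hA]
      exact Measurable.tsum fun n => (measurable_one.indicator hA).comp (h.measurable n)
    have h1 : ∫⁻ ω, pointMeasure X ω A ∂μ = ENNReal.ofReal lam * volume A := by
      rw [← lintegral_map (f := fun x => x) measurable_id hpm, h.law A hA hfin,
        lintegral_map (f := fun x => x) measurable_id .of_discrete,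
        lintegral_natCast_poissonMeasure]
      change ENNReal.ofReal _ = _
      rw [ENNReal.ofReal_mul' measureReal_nonneg, ofReal_measureReal hfin]
    rw [← h1, Measure.sum_apply _ hA]
    simp_rw [pointMeasure_apply X _ hA]
    rw [lintegral_tsum (f := fun n ω => A.indicator 1 (X n ω)) fun n =>
      ((measurable_one.indicator hA).comp (h.measurable n)).aemeasurable]
    congr 1 with n
    rw [Measure.map_apply (h.measurable n) hA, ← lintegral_indicator_one (h.measurable n hA)]
    rfl
  refine Measure.ext_of_iUnion_eq_univ (s := spanningSets volume)
    (iUnion_spanningSets _) fun n => ?_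
  ext A hA
  rw [Measure.restrict_apply hA, Measure.restrict_apply hA,
    key _ (hA.inter (measurableSet_spanningSets _ _))
      (ne_top_of_le_ne_top (measure_spanningSets_lt_top _ n).ne (measure_mono inter_subset_right))]
  rfl

/-- Campbell's formula. -/
theorem IsPPP.tsum_lintegral (h : IsPPP X lam μ) {f : Plane → ℝ≥0∞} (hf : Measurable f) :
    ∑' n, ∫⁻ ω, f (X n ω) ∂μ = ENNReal.ofReal lam * ∫⁻ z, f z := by
  have h1 := congrArg (fun ν => ∫⁻ z, f z ∂ν) h.sum_map
  simp only [lintegral_sum_measure, lintegral_smul_measure, smul_eq_mul] at h1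
  rw [← h1]
  congr 1 with n
  rw [lintegral_map hf (h.measurable n)]

/-- Borel–Cantelli: the probabilities sum to the expected number of points in the disk, which is
finite. -/
theorem IsPPP.ae_finite_norm_le (h : IsPPP X lam μ) (r : ℝ) :
    ∀ᵐ ω ∂μ, {n | ‖X n ω‖ ≤ r}.Finite := by
  rcases lt_or_ge r 0 with hr | hr
  · refine Filter.Eventually.of_forall fun ω => ?_
    convert Set.finite_empty
    ext n
    simpa using hr.trans_le (norm_nonneg _)
  have hm : MeasurableSet {x : Plane | ‖x‖ ≤ r} := measurableSet_le measurable_norm measurable_const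
  have h1 := congrArg (fun ν => ν {x : Plane | ‖x‖ ≤ r}) h.sum_map
  simp only [Measure.sum_apply _ hm, Measure.smul_apply, smul_eq_mul, volume_setOf_norm_le hr] at h1
  refine ae_finite_setOfPred_mem (s := fun n => {ω | ‖X n ω‖ ≤ r}) ?_
  have h2 : ∀ n, μ {ω | ‖X n ω‖ ≤ r} = (μ.map (X n)) {x : Plane | ‖x‖ ≤ r} := fun n => by
    rw [Measure.map_apply (h.measurable n) hm]; rfl
  simp_rw [h2, h1]
  exact ENNReal.mul_ne_top ENNReal.ofReal_ne_top ENNReal.ofReal_ne_top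

theorem IsPPP.void_probability (h : IsPPP X lam μ) (hlam : 0 ≤ lam) {r : ℝ} (hr : 0 ≤ r) :
    μ {ω | ∀ n, r ≤ ‖X n ω‖} = ENNReal.ofReal (Real.exp (-(Real.pi * lam * r ^ 2))) := by
  have hA : MeasurableSet {x : Plane | ‖x‖ < r} := measurableSet_lt measurable_norm measurable_const
  have hv := volume_setOf_norm_lt hr
  have hlaw := h.law _ hA (by rw [hv]; exact ENNReal.ofReal_ne_top)
  have hpm : Measurable fun ω => pointMeasure X ω {x : Plane | ‖x‖ < r} := by
    simp_rw [pointMeasure_apply X _ hA]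
    exact Measurable.tsum fun n => (measurable_one.indicator hA).comp (h.measurable n)
  have h1 := congrArg (fun ν => ν {0}) hlaw
  simp only [Measure.map_apply hpm (measurableSet_singleton _),
    Measure.map_apply (.of_discrete : Measurable fun n : ℕ => (n : ℝ≥0∞))
      (measurableSet_singleton _)] at h1
  have h2 : (fun n : ℕ => (n : ℝ≥0∞)) ⁻¹' {0} = {0} := by ext n; simp
  rw [h2, poissonMeasure_singleton, measureReal_def, hv,
    ENNReal.toReal_ofReal (by positivity), Real.coe_toNNReal _ (by positivity)] at h1
  simp only [pow_zero, mul_one, Nat.factorial_zero, Nat.cast_one, div_one] at h1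
  rw [show Real.pi * lam * r ^ 2 = lam * (Real.pi * r ^ 2) by ring, ← h1]
  congr 1
  ext ω
  simp only [mem_ofPred_eq, mem_preimage, mem_singleton_iff, pointMeasure_apply X ω hA,
    ENNReal.tsum_eq_zero, indicator_apply_eq_zero, Pi.one_apply, one_ne_zero, imp_false, not_lt]

end Poisson

/-! ### Distances to tiers as functions of centres and marks -/

/-- The distance to the nearest of the points `c + y l`, `l < N`. -/
noncomputable def clusterRadius (c : Plane) (N : ℕ) (y : ℕ → Plane) : ℝ≥0∞ :=
  ⨅ l, if l < N then ENNReal.ofReal ‖c + y l‖ else ∞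

theorem measurable_clusterRadius {X : Type*} [MeasurableSpace X] {c : X → Plane} {N : X → ℕ}
    {y : ℕ → X → Plane} (hc : Measurable c) (hN : Measurable N) (hy : ∀ l, Measurable (y l)) :
    Measurable fun x => clusterRadius (c x) (N x) fun l => y l x :=
  Measurable.iInf fun l => Measurable.ite (measurableSet_lt measurable_const hN)
    (hc.add (hy l)).norm.ennreal_ofReal measurable_const

/-- No sign condition on $r$ is needed: for $r<0$ both sides are trivially true. An empty cluster
has radius $\infty$. -/
theorem ofReal_le_clusterRadius {c : Plane} {N : ℕ} {y : ℕ → Plane} {r : ℝ} :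
    ENNReal.ofReal r ≤ clusterRadius c N y ↔ ∀ l < N, r ≤ ‖c + y l‖ := by
  rw [clusterRadius, le_iInf_iff]
  refine forall_congr' fun l => ?_
  split_ifs with h
  · rw [ENNReal.ofReal_le_ofReal_iff (norm_nonneg _)]
    simp [h]
  · simp [h]

/-- Cluster centres of all tiers. -/
abbrev Centers (K₁ : Type*) : Type _ := K₁ → Option ℕ → Plane

/-- Cluster sizes, offspring offsets, and stations of the Poisson tiers. -/
abbrev Marks (K₁ K₂ : Type*) : Type _ :=
  (K₁ → Option ℕ → ℕ) × (K₁ → Option ℕ → ℕ → Plane) × (K₂ → ℕ → Plane)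

section Deterministic

variable {K₁ K₂ : Type*} (q : Option K₁)

/-- The BSs of a tier as a function of the cluster centres and the remaining randomness. -/
def bsSet (z : Centers K₁) (w : Marks K₁ K₂) : K₁ ⊕ K₂ → Set Plane
  | .inl k => {x | ∃ (n : Data.ClusterIndex q k) (l : ℕ),
    l < w.1 k n.1 ∧ x = z k n.1 + w.2.1 k n.1 l}
  | .inr k => {x | ∃ n : ℕ, x = w.2.2 k n}

/-- The distance from the origin to a tier. -/
noncomputable def radius (z : Centers K₁) (w : Marks K₁ K₂) : K₁ ⊕ K₂ → ℝ≥0∞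
  | .inl k => ⨅ n : Data.ClusterIndex q k, clusterRadius (z k n.1) (w.1 k n.1) (w.2.1 k n.1)
  | .inr k => ⨅ n, ENNReal.ofReal ‖w.2.2 k n‖

variable {q}

theorem ofReal_le_radius {z : Centers K₁} {w : Marks K₁ K₂} {k : K₁ ⊕ K₂} {r : ℝ} :
    ENNReal.ofReal r ≤ radius q z w k ↔ ∀ x ∈ bsSet q z w k, r ≤ ‖x‖ := by
  cases k with
  | inl k =>
    simp only [radius, le_iInf_iff, ofReal_le_clusterRadius, bsSet, Set.mem_ofPred_eq]
    constructor
    · rintro h x ⟨n, l, hl, rfl⟩; exact h n l hl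
    · intro h n l hl; exact h _ ⟨n, l, hl, rfl⟩
  | inr k =>
    simp only [radius, le_iInf_iff, bsSet, Set.mem_ofPred_eq,
      ENNReal.ofReal_le_ofReal_iff (norm_nonneg _)]
    constructor
    · rintro h x ⟨n, rfl⟩; exact h n
    · intro h n; exact h _ ⟨n, rfl⟩

theorem radius_le {z : Centers K₁} {w : Marks K₁ K₂} {k : K₁ ⊕ K₂} {x : Plane}
    (hx : x ∈ bsSet q z w k) : radius q z w k ≤ ENNReal.ofReal ‖x‖ := by
  cases k with
  | inl k =>
    obtain ⟨n, l, hl, rfl⟩ := hx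
    refine (iInf_le _ n).trans ((iInf_le _ l).trans ?_)
    rw [if_pos hl]
  | inr k =>
    obtain ⟨n, rfl⟩ := hx
    exact iInf_le _ n

/-- The tier has a point nearest to the origin. -/
def Attained (q : Option K₁) (z : Centers K₁) (w : Marks K₁ K₂) (k : K₁ ⊕ K₂) : Prop :=
  ∃ x ∈ bsSet q z w k, ENNReal.ofReal ‖x‖ = radius q z w k

theorem Attained.norm_nearest {z : Centers K₁} {w : Marks K₁ K₂} {k : K₁ ⊕ K₂}
    (h : Attained q z w k) : ‖nearest (bsSet q z w k)‖ = (radius q z w k).toReal := by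
  obtain ⟨x, hx, hr⟩ := h
  have h2 : ∀ y ∈ bsSet q z w k, ‖x‖ ≤ ‖y‖ := ofReal_le_radius.1 hr.le
  have h3 : ∃ x ∈ bsSet q z w k, ∀ y ∈ bsSet q z w k, ‖x‖ ≤ ‖y‖ := ⟨x, hx, h2⟩
  rw [nearest, dif_pos h3, ← hr, ENNReal.toReal_ofReal (norm_nonneg _)]
  exact le_antisymm (h3.choose_spec.2 x hx) (h2 _ h3.choose_spec.1)

theorem Attained.radius_ne_top {z : Centers K₁} {w : Marks K₁ K₂} {k : K₁ ⊕ K₂}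
    (h : Attained q z w k) : radius q z w k ≠ ∞ := by
  obtain ⟨x, -, hr⟩ := h
  rw [← hr]; exact ENNReal.ofReal_ne_top

/-- A finite radius provides a point $x_0$ of the tier; only the finitely many points in a disk
containing $x_0$ compete for the minimum. -/
theorem attained_of_finite {z : Centers K₁} {w : Marks K₁ K₂} {k : K₁ ⊕ K₂}
    (hne : radius q z w k ≠ ∞) (hfin : ∀ N : ℕ, {x ∈ bsSet q z w k | ‖x‖ < N}.Finite) :
    Attained q z w k := by
  have hex : (bsSet q z w k).Nonempty := by
    by_contra h
    rw [Set.not_nonempty_iff_eq_empty] at h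
    refine hne (ENNReal.eq_top_of_forall_nnreal_le fun r => ?_)
    rw [← ENNReal.ofReal_coe_nnreal, ofReal_le_radius, h]
    simp
  obtain ⟨x₀, hx₀⟩ := hex
  obtain ⟨N, hN⟩ := exists_nat_gt ‖x₀‖
  obtain ⟨x, hx, hmin⟩ := (hfin N).exists_minimalFor (fun x => ‖x‖) _ ⟨x₀, hx₀, hN⟩
  refine ⟨x, hx.1, le_antisymm (ofReal_le_radius.2 fun y hy => ?_) (radius_le hx.1)⟩
  rcases lt_or_ge ‖y‖ N with h | h
  · rcases le_total ‖x‖ ‖y‖ with h' | h'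
    · exact h'
    · exact hmin ⟨hy, h⟩ h'
  · exact hx.2.le.trans h

theorem measurable_radius (k : K₁ ⊕ K₂) :
    Measurable fun x : Centers K₁ × Marks K₁ K₂ => radius q x.1 x.2 k := by
  cases k with
  | inl k =>
    exact Measurable.iInf fun n => measurable_clusterRadius (by fun_prop) (by fun_prop)
      fun l => by fun_prop
  | inr k =>
    exact Measurable.iInf fun n => by fun_prop

/-- The existential over points of the plane is a countable union over labels of points. -/
theorem measurableSet_attained (k : K₁ ⊕ K₂) :
    MeasurableSet {x : Centers K₁ × Marks K₁ K₂ | Attained q x.1 x.2 k} := by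
  cases k with
  | inl k =>
    have h : {x : Centers K₁ × Marks K₁ K₂ | Attained q x.1 x.2 (.inl k)}
        = ⋃ (n : Data.ClusterIndex q k) (l : ℕ), {x | l < x.2.1 k n.1} ∩
          {x | ENNReal.ofReal ‖x.1 k n.1 + x.2.2.1 k n.1 l‖ = radius q x.1 x.2 (.inl k)} := by
      ext x
      simp only [Attained, bsSet, Set.mem_ofPred_eq, Set.mem_iUnion, Set.mem_inter_iff]
      constructor
      · rintro ⟨_, ⟨n, l, hl, rfl⟩, h⟩; exact ⟨n, l, hl, h⟩
      · rintro ⟨n, l, hl, h⟩; exact ⟨_, ⟨n, l, hl, rfl⟩, h⟩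
    rw [h]
    exact MeasurableSet.iUnion fun n => MeasurableSet.iUnion fun l =>
      (measurableSet_lt (by fun_prop) (by fun_prop)).inter
        (measurableSet_eq_fun (by fun_prop) (measurable_radius _))
  | inr k =>
    have h : {x : Centers K₁ × Marks K₁ K₂ | Attained q x.1 x.2 (.inr k)}
        = ⋃ n : ℕ, {x | ENNReal.ofReal ‖x.2.2.2 k n‖ = radius q x.1 x.2 (.inr k)} := by
      ext x
      simp only [Attained, bsSet, Set.mem_ofPred_eq, Set.mem_iUnion]
      constructor
      · rintro ⟨_, ⟨n, rfl⟩, h⟩; exact ⟨n, h⟩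
      · rintro ⟨n, h⟩; exact ⟨_, ⟨n, rfl⟩, h⟩
    rw [h]
    exact MeasurableSet.iUnion fun n =>
      measurableSet_eq_fun (by fun_prop) (measurable_radius _)

end Deterministic

/-! ### Independence of sources and the void probability of a cluster -/

section Independence

variable {K₁ K₂ Ω : Type*} (D : Data K₁ K₂ Ω)

/-- The cluster centres of all tiers, as a random variable. -/
def centers (ω : Ω) : Centers K₁ := fun k n => D.center k n ω

/-- All the randomness except for the cluster centres. -/
def marks (ω : Ω) : Marks K₁ K₂ :=
  (fun k n => D.size k n ω, fun k n l => D.offset k n l ω, fun k n => D.station k n ω)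

theorem stations_eq_bsSet (q : Option K₁) (ω : Ω) (k : K₁ ⊕ K₂) :
    D.stations q ω k = bsSet q (centers D ω) (marks D ω) k := by
  cases k <;> rfl

/-- The sources of randomness of one cluster. -/
def clusterSources (k : K₁) (n : Option ℕ) : Set (Source K₁ K₂) :=
  {s | s = .size k n ∨ ∃ l, s = .offset k n l}

/-- The sources of randomness of one tier, apart from the cluster centres. -/
def tierSources : K₁ ⊕ K₂ → Set (Source K₁ K₂)
  | .inl k => {s | ∃ n, s ∈ clusterSources k n}
  | .inr k => {.station k}

theorem pairwise_disjoint_clusterSources (k : K₁) :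
    Pairwise fun n m : Option ℕ =>
      Disjoint (clusterSources (K₂ := K₂) k n) (clusterSources k m) := by
  intro n m hnm
  rw [Set.disjoint_left]
  rintro s (rfl | ⟨l, rfl⟩) (h | ⟨l', h⟩) <;> cases h <;> exact hnm rfl

theorem pairwise_disjoint_tierSources :
    Pairwise fun k j : K₁ ⊕ K₂ => Disjoint (tierSources k) (tierSources j) := by
  intro k j hkj
  rw [Set.disjoint_left]
  rcases k with k | k <;> rcases j with j | j
  · rintro s ⟨n, rfl | ⟨l, rfl⟩⟩ ⟨m, h | ⟨l', h⟩⟩ <;> cases h <;> exact hkj rfl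
  · rintro s ⟨n, rfl | ⟨l, rfl⟩⟩ h <;> cases h
  · rintro s rfl ⟨m, h | ⟨l', h⟩⟩ <;> cases h
  · rintro s rfl h; cases h; exact hkj rfl

variable {D}

theorem measurable_marks {m : MeasurableSpace Ω} (hs : ∀ k n, Measurable (D.size k n))
    (ho : ∀ k n l, Measurable (D.offset k n l)) (ht : ∀ k n, Measurable (D.station k n)) :
    Measurable (marks D) :=
  (measurable_pi_iff.2 fun k => measurable_pi_iff.2 fun n => hs k n).prodMk
    ((measurable_pi_iff.2 fun k => measurable_pi_iff.2 fun n => measurable_pi_iff.2 fun l =>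
      ho k n l).prodMk (measurable_pi_iff.2 fun k => measurable_pi_iff.2 fun n => ht k n))

theorem measurable_centers {m : MeasurableSpace Ω} (hc : ∀ k n, Measurable (D.center k n)) :
    Measurable (centers D) :=
  measurable_pi_iff.2 fun k => measurable_pi_iff.2 fun n => hc k n

theorem measurable_radius_inl {m : MeasurableSpace Ω} (q : Option K₁) (z : Centers K₁) {k : K₁}
    (hs : ∀ n, Measurable (D.size k n)) (ho : ∀ n l, Measurable (D.offset k n l)) :
    Measurable fun ω => radius q z (marks D ω) (.inl k) :=
  Measurable.iInf fun n => measurable_clusterRadius measurable_const (hs n.1) fun l => ho n.1 l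

theorem measurable_radius_inr {m : MeasurableSpace Ω} (q : Option K₁) (z : Centers K₁) {k : K₂}
    (ht : ∀ n, Measurable (D.station k n)) :
    Measurable fun ω => radius q z (marks D ω) (.inr k) :=
  Measurable.iInf fun n => (ht n).norm.ennreal_ofReal

theorem measurable_pi_comap {ι : Type*} (f : ι → Ω → Plane) (i : ι) :
    Measurable[MeasurableSpace.comap (fun ω i => f i ω) inferInstance] (f i) :=
  (measurable_pi_apply i).comp (comap_measurable (fun ω i => f i ω))

theorem measurable_size_of_mem {S : Set (Source K₁ K₂)} {k : K₁} {n : Option ℕ}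
    (h : Source.size k n ∈ S) : Measurable[⨆ s ∈ S, D.sigma s] (D.size k n) :=
  (comap_measurable (D.size k n)).mono (le_iSup₂ (f := fun s (_ : s ∈ S) => D.sigma s) _ h) le_rfl

theorem measurable_offset_of_mem {S : Set (Source K₁ K₂)} {k : K₁} {n : Option ℕ} {l : ℕ}
    (h : Source.offset k n l ∈ S) : Measurable[⨆ s ∈ S, D.sigma s] (D.offset k n l) :=
  (comap_measurable (D.offset k n l)).mono
    (le_iSup₂ (f := fun s (_ : s ∈ S) => D.sigma s) _ h) le_rfl

theorem measurable_station_of_mem {S : Set (Source K₁ K₂)} {k : K₂} (n : ℕ)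
    (h : Source.station k ∈ S) : Measurable[⨆ s ∈ S, D.sigma s] (D.station k n) :=
  (measurable_pi_comap (D.station k) n).mono
    (le_iSup₂ (f := fun s (_ : s ∈ S) => D.sigma s) _ h) le_rfl

theorem measurable_parent_of_mem {S : Set (Source K₁ K₂)} {k : K₁} (n : ℕ)
    (h : Source.parent k ∈ S) : Measurable[⨆ s ∈ S, D.sigma s] (D.parent k n) :=
  (measurable_pi_comap (D.parent k) n).mono
    (le_iSup₂ (f := fun s (_ : s ∈ S) => D.sigma s) _ h) le_rfl

theorem measurable_z₀_of_mem {S : Set (Source K₁ K₂)} (h : Source.center ∈ S) :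
    Measurable[⨆ s ∈ S, D.sigma s] D.z₀ :=
  (comap_measurable D.z₀).mono (le_iSup₂ (f := fun s (_ : s ∈ S) => D.sigma s) _ h) le_rfl

variable [MeasurableSpace Ω] {μ : Measure Ω} {p : Params K₁ K₂}

theorem distCDF_le_one (p : Params K₁ K₂) (k : K₁) (r : ℝ) (c : Plane) :
    distCDF (p.g k) r c ≤ 1 := by
  have := isProbabilityMeasure_distLaw (p.g_lintegral k) c
  exact measureReal_le_one

theorem IsModel.sigma_le (hD : IsModel p D μ) (s : Source K₁ K₂) :
    D.sigma s ≤ ‹MeasurableSpace Ω› := by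
  cases s with
  | parent k => exact (measurable_pi_iff.2 fun n => (hD.parent_ppp k).measurable n).comap_le
  | center => exact hD.z₀_measurable.comap_le
  | size k n => exact (hD.size_measurable k n).comap_le
  | offset k n l => exact (hD.offset_measurable k n l).comap_le
  | station k => exact (measurable_pi_iff.2 fun n => (hD.station_ppp k).measurable n).comap_le

theorem IsModel.measurable_center (hD : IsModel p D μ) (k : K₁) (n : Option ℕ) :
    Measurable (D.center k n) := by
  cases n with
  | none => exact hD.z₀_measurable
  | some n => exact (hD.parent_ppp k).measurable n

theorem IsModel.measurable_centers (hD : IsModel p D μ) : Measurable (centers D) :=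
  HetNet.measurable_centers hD.measurable_center

theorem IsModel.measurable_marks (hD : IsModel p D μ) : Measurable (marks D) :=
  HetNet.measurable_marks hD.size_measurable hD.offset_measurable fun k =>
    (hD.station_ppp k).measurable

/-- The sources split into those carrying centres and their complement. This is what allows the
centres to be frozen. -/
theorem IsModel.indepFun_centers_marks (hD : IsModel p D μ) : IndepFun (centers D) (marks D) μ := by
  set S : Set (Source K₁ K₂) := {s | s = .center ∨ ∃ k, s = .parent k} with hS
  have h := indep_iSup_of_disjoint hD.sigma_le hD.indep (disjoint_compl_right (a := S))
  rw [IndepFun_iff_Indep]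
  refine indep_of_indep_of_le_left (indep_of_indep_of_le_right h ?_) ?_
  · refine Measurable.comap_le (HetNet.measurable_marks ?_ ?_ ?_)
    · exact fun k n => measurable_size_of_mem (by simp [hS])
    · exact fun k n l => measurable_offset_of_mem (by simp [hS])
    · exact fun k n => measurable_station_of_mem n (by simp [hS])
  · refine Measurable.comap_le (HetNet.measurable_centers fun k n => ?_)
    cases n with
    | none => exact measurable_z₀_of_mem (by simp [hS])
    | some n => exact measurable_parent_of_mem n (by simp [hS])

/-- For fixed cluster centres, the distances to the tiers are independent. -/
theorem IsModel.iIndepFun_radius (hD : IsModel p D μ) [IsProbabilityMeasure μ] (q : Option K₁)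
    (z : Centers K₁) :
    iIndepFun (fun k ω => radius q z (marks D ω) k) μ := by
  rw [iIndepFun_iff_iIndep]
  refine iIndep_of_iIndep_of_le
    (iIndep_biSup hD.sigma_le hD.indep _ pairwise_disjoint_tierSources) fun k => ?_
  refine Measurable.comap_le ?_
  cases k with
  | inl k =>
    refine measurable_radius_inl q z (fun n => ?_) fun n l => ?_
    · exact measurable_size_of_mem ⟨n, Or.inl rfl⟩
    · exact measurable_offset_of_mem ⟨n, Or.inr ⟨l, rfl⟩⟩
  | inr k => exact measurable_radius_inr q z fun n => measurable_station_of_mem n rfl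

/-- For fixed cluster centres, the distances to the clusters of a tier are independent. -/
theorem IsModel.iIndepFun_clusterRadius (hD : IsModel p D μ) [IsProbabilityMeasure μ] (k : K₁)
    (c : Option ℕ → Plane) :
    iIndepFun (fun n ω => clusterRadius (c n) (D.size k n ω) fun l => D.offset k n l ω) μ := by
  rw [iIndepFun_iff_iIndep]
  refine iIndep_of_iIndep_of_le
    (iIndep_biSup hD.sigma_le hD.indep _ (pairwise_disjoint_clusterSources k)) fun n => ?_
  refine Measurable.comap_le (@measurable_clusterRadius _ (_) _ _ _ (@measurable_const _ _ _ (_) _)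
    ?_ fun l => ?_)
  · exact measurable_size_of_mem (Or.inl rfl)
  · exact measurable_offset_of_mem (Or.inr ⟨l, rfl⟩)

theorem IsModel.measure_offset (hD : IsModel p D μ) (k : K₁) (n : Option ℕ) (l : ℕ) (c : Plane)
    (r : ℝ) :
    μ {ω | r ≤ ‖c + D.offset k n l ω‖} = ENNReal.ofReal (1 - distCDF (p.g k) r c) := by
  have := isProbabilityMeasure_distLaw (p.g_lintegral k) c
  have h1 : μ {ω | r ≤ ‖c + D.offset k n l ω‖} = distLaw (p.g k) c (Set.Ici r) := by
    rw [distLaw_eq_map, densityLaw, ← hD.offset_law k n l, Measure.map_map (by fun_prop)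
      (hD.offset_measurable k n l), Measure.map_apply ((by fun_prop : Measurable fun x : Plane =>
        ‖c + x‖).comp (hD.offset_measurable k n l)) measurableSet_Ici]
    rfl
  rw [h1, ← Set.compl_Iio, prob_compl_eq_one_sub measurableSet_Iio, distLaw_Iio,
    ENNReal.ofReal_sub _ (show 0 ≤ distCDF (p.g k) r c from measureReal_nonneg),
    ofReal_distCDF (p.g_lintegral k),
    ENNReal.ofReal_one]

/-- The probability that no point of a given cluster is closer than `r`. -/
theorem IsModel.measure_clusterRadius (hD : IsModel p D μ) [IsProbabilityMeasure μ] (k : K₁)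
    (n : Option ℕ) (c : Plane)
    (r : ℝ) :
    μ {ω | ENNReal.ofReal r ≤ clusterRadius c (D.size k n ω) fun l => D.offset k n l ω}
      = ENNReal.ofReal (Real.exp (-(p.mbar k * distCDF (p.g k) r c))) := by
  set A : ℕ → Set Ω := fun l => {ω | r ≤ ‖c + D.offset k n l ω‖} with hA
  set x : ℝ := 1 - distCDF (p.g k) r c with hx
  have hx0 : 0 ≤ x := sub_nonneg.2 (distCDF_le_one p k r c)
  have hm := (p.mbar_pos k).le
  -- Split by the size $j$ of the cluster: each of the $j$ points avoids the disk with probability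
  -- $x=1-F$, and $\sum_j e^{-\bar m}(\bar m x)^j/j!=e^{-\bar m F}$.
  have hset : {ω | ENNReal.ofReal r ≤ clusterRadius c (D.size k n ω) fun l => D.offset k n l ω}
      = ⋃ j : ℕ, D.size k n ⁻¹' {j} ∩ ⋂ l ∈ Finset.range j, A l := by
    ext ω
    simp [ofReal_le_clusterRadius, hA]
  have hAm : ∀ l, MeasurableSet (A l) := fun l =>
    measurableSet_le measurable_const ((hD.offset_measurable k n l).const_add c).norm
  have hjm : ∀ j, MeasurableSet (D.size k n ⁻¹' {j}) := fun j =>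
    hD.size_measurable k n (measurableSet_singleton j)
  have hind : ∀ j : ℕ, μ (D.size k n ⁻¹' {j} ∩ ⋂ l ∈ Finset.range j, A l)
      = ENNReal.ofReal (Real.exp (-p.mbar k) * ((p.mbar k * x) ^ j / j.factorial)) := by
    intro j
    -- `none` stands for the size and `some l` for the offsets, so a single independent family
    -- covers both.
    let f : Option ℕ → Source K₁ K₂ := fun o => o.elim (.size k n) (.offset k n)
    have hf : Function.Injective f := by
      rintro (_ | a) (_ | b) h <;> simp_all [f]
    have hpre := hD.indep.precomp hf
    have := hpre.meas_biInter (S := Finset.insertNone (Finset.range j))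
      (s := fun o => o.elim (D.size k n ⁻¹' {j}) A) (fun o _ => by
        cases o with
        | none => exact ⟨{j}, measurableSet_singleton j, rfl⟩
        | some l => exact ⟨{y | r ≤ ‖c + y‖}, measurableSet_le measurable_const (by fun_prop), rfl⟩)
    rw [Finset.prod_insertNone] at this
    have hI : (⋂ o ∈ Finset.insertNone (Finset.range j),
        Option.elim o (D.size k n ⁻¹' {j}) A) = D.size k n ⁻¹' {j} ∩ ⋂ l ∈ Finset.range j, A l := by
      ext ω
      simp [Option.forall]
    rw [hI] at this
    rw [this]
    have h1 : μ (D.size k n ⁻¹' {j})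
        = ENNReal.ofReal (Real.exp (-p.mbar k) * p.mbar k ^ j / j.factorial) := by
      rw [← Measure.map_apply (hD.size_measurable k n) (measurableSet_singleton j), hD.size_law,
        poissonMeasure_singleton, Real.coe_toNNReal _ hm]
    have h2 : ∀ l, μ (A l) = ENNReal.ofReal x := fun l => hD.measure_offset k n l c r
    simp only [Option.elim, h1, h2, Finset.prod_const, Finset.card_range]
    rw [← ENNReal.ofReal_pow hx0, ← ENNReal.ofReal_mul (by positivity)]
    congr 1
    rw [mul_pow]; ring
  have hexp : HasSum (fun j : ℕ => Real.exp (-p.mbar k) * ((p.mbar k * x) ^ j / j.factorial))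
      (Real.exp (-p.mbar k) * Real.exp (p.mbar k * x)) := by
    have := NormedSpace.expSeries_div_hasSum_exp (p.mbar k * x)
    rw [← Real.exp_eq_exp_ℝ] at this
    exact this.mul_left _
  rw [hset, measure_iUnion]
  · simp_rw [hind]
    rw [← ENNReal.ofReal_tsum_of_nonneg (fun j => by positivity) hexp.summable, hexp.tsum_eq,
      ← Real.exp_add]
    congr 2
    rw [hx]; ring
  · intro i j hij
    rw [Function.onFun, Set.disjoint_left]
    rintro ω ⟨h1, -⟩ ⟨h2, -⟩
    exact hij (h1.symm.trans h2)
  · exact fun j => (hjm j).inter (Finset.measurableSet_biInter _ fun l _ => hAm l)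

end Independence

/-! ### Hazard rates as measurable functions of the parent processes -/

section Hazard

open Set

/-- The integral of a function with a parameter against a locally finite measure is a jointly
measurable function of the measure and the parameter. -/
theorem exists_measurable_lintegral {f : Plane × ℝ → ℝ≥0∞} (hf : Measurable f) :
    ∃ H : Measure Plane × ℝ → ℝ≥0∞, Measurable H ∧
      ∀ φ : Measure Plane, (∀ n : ℕ, φ {z | ‖z‖ ≤ n} ≠ ∞) → ∀ r, H (φ, r) = ∫⁻ z, f (z, r) ∂φ := by
  -- The plane is cut into bounded annuli. On each, division by $1+\varphi(A_n)$ turns $\varphi$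
  -- into a kernel of mass at most one, and the factor is restored after integration. If
  -- $\varphi(A_n)=\infty$ the kernel is zero, which is why the formula is claimed only for locally
  -- finite $\varphi$.
  set A : ℕ → Set Plane := fun n => {z | ⌊‖z‖⌋₊ = n} with hA
  have hAm : ∀ n, MeasurableSet (A n) := fun n =>
    (Nat.measurable_floor.comp measurable_norm) (measurableSet_singleton n)
  have hmA : ∀ n, Measurable fun φ : Measure Plane => 1 + φ (A n) := fun n =>
    (Measure.measurable_coe (hAm n)).const_add 1
  have hκm : ∀ n, Measurable fun φ : Measure Plane => (1 + φ (A n))⁻¹ • φ.restrict (A n) := by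
    intro n
    refine Measure.measurable_of_measurable_coe _ fun s hs => ?_
    simp only [Measure.smul_apply, smul_eq_mul, Measure.restrict_apply hs]
    exact (hmA n).inv.mul (Measure.measurable_coe (hs.inter (hAm n)))
  let κ : ℕ → Kernel (Measure Plane) Plane := fun n => ⟨_, hκm n⟩
  have hκ : ∀ n, IsFiniteKernel (κ n) := by
    refine fun n => ⟨1, ENNReal.one_lt_top, fun φ => ?_⟩
    change ((1 + φ (A n))⁻¹ • φ.restrict (A n)) univ ≤ 1
    simp only [Measure.smul_apply, smul_eq_mul, Measure.restrict_apply_univ]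
    rw [mul_comm, ← div_eq_mul_inv]
    exact ENNReal.div_le_of_le_mul (by rw [one_mul]; exact le_add_self)
  refine ⟨fun x => ∑' n, (1 + x.1 (A n)) * ∫⁻ z, f (z, x.2) ∂(κ n x.1), ?_, ?_⟩
  · refine Measurable.tsum fun n => ((hmA n).comp measurable_fst).mul ?_
    exact Measurable.lintegral_kernel_prod_right' (κ := (κ n).comap Prod.fst measurable_fst)
      (f := fun y : (Measure Plane × ℝ) × Plane => f (y.2, y.1.2)) (by fun_prop)
  · intro φ hφ r
    have h1 : ∀ n, (1 + φ (A n)) * ∫⁻ z, f (z, r) ∂(κ n φ) = ∫⁻ z in A n, f (z, r) ∂φ := by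
      intro n
      have hfin : φ (A n) ≠ ∞ := by
        refine ne_top_of_le_ne_top (hφ (n + 1)) (measure_mono fun z hz => ?_)
        have := (Nat.lt_floor_add_one ‖z‖).le
        rw [show ⌊‖z‖⌋₊ = n from hz] at this
        simpa using this
      change (1 + φ (A n)) * ∫⁻ z, f (z, r) ∂((1 + φ (A n))⁻¹ • φ.restrict (A n)) = _
      rw [lintegral_smul_measure, smul_eq_mul, ← mul_assoc, ENNReal.mul_inv_cancel, one_mul]
      · simp
      · simpa using hfin
    have hU : ⋃ n, A n = univ := by ext z; simp [hA]
    simp only [h1]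
    rw [← lintegral_iUnion hAm, hU, setLIntegral_univ]
    intro i j hij
    rw [Function.onFun, Set.disjoint_left]
    rintro z (h1 : _ = i) (h2 : _ = j)
    exact hij (h1.symm.trans h2)

variable {K₁ K₂ : Type*} (p : Params K₁ K₂)

/-- A jointly measurable version of the density of the distance of an offspring point. -/
noncomputable def Params.density (k : K₁) : Plane × ℝ → ℝ≥0∞ :=
  (exists_measurable_distLaw_density (p.g_lintegral k)).choose

theorem Params.measurable_density (k : K₁) : Measurable (p.density k) :=
  (exists_measurable_distLaw_density (p.g_lintegral k)).choose_spec.1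

theorem Params.distLaw_eq (k : K₁) (z : Plane) :
    distLaw (p.g k) z = volume.withDensity fun r => p.density k (z, r) :=
  (exists_measurable_distLaw_density (p.g_lintegral k)).choose_spec.2 z

/-- The sum of the distance densities over the points of a locally finite counting measure. -/
noncomputable def Params.densitySum (k : K₁) : Measure Plane × ℝ → ℝ≥0∞ :=
  (exists_measurable_lintegral (p.measurable_density k)).choose

theorem Params.measurable_densitySum (k : K₁) : Measurable (p.densitySum k) :=
  (exists_measurable_lintegral (p.measurable_density k)).choose_spec.1

theorem Params.densitySum_eq (k : K₁) {φ : Measure Plane} (hφ : ∀ n : ℕ, φ {z | ‖z‖ ≤ n} ≠ ∞)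
    (r : ℝ) : p.densitySum k (φ, r) = ∫⁻ z, p.density k (z, r) ∂φ :=
  (exists_measurable_lintegral (p.measurable_density k)).choose_spec.2 φ hφ r

/-- The hazard rate of the distance to a tier, given the parent point processes. -/
noncomputable def hazard (φ : K₁ → Measure Plane) : K₁ ⊕ K₂ → ℝ → ℝ≥0∞
  | .inl k, r => ENNReal.ofReal (p.mbar k) * p.densitySum k (φ k, r)
  | .inr k, r => ENNReal.ofReal (2 * (Real.pi * p.lam k) * r)

/-- The cumulative hazard of the distance to a tier. -/
noncomputable def cumHazard (φ : K₁ → Measure Plane) (k : K₁ ⊕ K₂) (r : ℝ) : ℝ≥0∞ :=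
  ∫⁻ s in Icc 0 r, hazard p φ k s

theorem measurable_hazard (k : K₁ ⊕ K₂) :
    Measurable fun x : (K₁ → Measure Plane) × ℝ => hazard p x.1 k x.2 := by
  cases k with
  | inl k =>
    exact ((p.measurable_densitySum k).comp
      (((measurable_pi_apply k).comp measurable_fst).prodMk measurable_snd)).const_mul _
  | inr k => simp only [hazard]; fun_prop

theorem measurable_cumHazard (k : K₁ ⊕ K₂) :
    Measurable fun x : (K₁ → Measure Plane) × ℝ => cumHazard p x.1 k x.2 :=
  measurable_lintegral_Icc (measurable_hazard p k)

theorem measurable_hazard_right (φ : K₁ → Measure Plane) (k : K₁ ⊕ K₂) :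
    Measurable (hazard p φ k) :=
  (measurable_hazard p k).comp measurable_prodMk_left

variable (q : Option K₁)

/-- The parent point processes as a function of the cluster centres. -/
noncomputable def centerPP (z : Centers K₁) (k : K₁) : Measure Plane :=
  pointMeasure (fun (n : Data.ClusterIndex q k) (z : Centers K₁) => z k n.1) z

/-- Configurations of cluster centres that are locally finite and have locally finite intensity of
offspring distances. -/
structure Good (z : Centers K₁) : Prop where
  locallyFinite : ∀ k (n : ℕ), centerPP q z k {x | ‖x‖ ≤ n} ≠ ∞
  summable : ∀ k r, ∑' n : Data.ClusterIndex q k, distLaw (p.g k) (z k n.1) (Iic r) ≠ ∞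

variable {p q} {z : Centers K₁}

theorem Good.hazard_inl (hz : Good p q z) (k : K₁) (r : ℝ) :
    hazard p (centerPP q z) (.inl k) r
      = ENNReal.ofReal (p.mbar k) * ∑' n : Data.ClusterIndex q k, p.density k (z k n.1, r) := by
  rw [hazard, p.densitySum_eq k (hz.locallyFinite k), centerPP,
    lintegral_pointMeasure (f := fun z => p.density k (z, r)) _ _
      ((p.measurable_density k).comp measurable_prodMk_right)]

/-- Tonelli over the countably many centres; intervals $[0,r]$ give the cumulative hazard and the
half-line gives the total hazard. -/
theorem Good.setLIntegral_hazard_inl (hz : Good p q z) (k : K₁) (s : Set ℝ) :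
    ∫⁻ r in s, hazard p (centerPP q z) (.inl k) r = ENNReal.ofReal (p.mbar k) *
      ∑' n : Data.ClusterIndex q k, ∫⁻ r in s, p.density k (z k n.1, r) := by
  have hm : ∀ n : Data.ClusterIndex q k, Measurable fun r => p.density k (z k n.1, r) := fun n =>
    (p.measurable_density k).comp measurable_prodMk_left
  simp_rw [hz.hazard_inl]
  rw [lintegral_const_mul _ (Measurable.tsum hm), lintegral_tsum fun n => (hm n).aemeasurable]

theorem Good.cumHazard_inl (hz : Good p q z) (k : K₁) (r : ℝ) :
    cumHazard p (centerPP q z) (.inl k) r = ENNReal.ofReal (p.mbar k) *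
      ∑' n : Data.ClusterIndex q k, distLaw (p.g k) (z k n.1) (Iic r) := by
  rw [cumHazard, hz.setLIntegral_hazard_inl]
  simp_rw [distLaw_Iic (p.g k) _ (p.distLaw_eq k _)]

theorem cumHazard_inr (p : Params K₁ K₂) (φ : K₁ → Measure Plane) (k : K₂) {r : ℝ} (hr : 0 ≤ r) :
    cumHazard p φ (.inr k) r = ENNReal.ofReal (Real.pi * p.lam k * r ^ 2) :=
  lintegral_Icc_linear (mul_nonneg Real.pi_pos.le (p.lam_pos k).le) hr

theorem Good.cumHazard_ne_top (hz : Good p q z) (k : K₁ ⊕ K₂) (r : ℝ) :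
    cumHazard p (centerPP q z) k r ≠ ∞ := by
  cases k with
  | inl k =>
    rw [hz.cumHazard_inl]
    exact ENNReal.mul_ne_top ENNReal.ofReal_ne_top (hz.summable k r)
  | inr k =>
    rcases le_or_gt 0 r with hr | hr
    · rw [cumHazard_inr p _ k hr]; exact ENNReal.ofReal_ne_top
    · rw [cumHazard, Icc_eq_empty (not_le.2 hr)]; simp

instance (k : K₁) : Infinite (Data.ClusterIndex q k) :=
  Infinite.of_injective (fun n : ℕ => ⟨some n, by simp⟩) fun a b h => by simpa using h

/-- A clustered tier has infinitely many clusters, each contributing total mass $\bar m_k$; for a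
Poisson tier $\pi\lambda_k r^2$ is unbounded. -/
theorem Good.lintegral_hazard_eq_top (hz : Good p q z) (k : K₁ ⊕ K₂) :
    ∫⁻ r in Ici 0, hazard p (centerPP q z) k r = ∞ := by
  cases k with
  | inl k =>
    have h1 : ∀ n : Data.ClusterIndex q k, ∫⁻ r in Ici 0, p.density k (z k n.1, r) = 1 := by
      intro n
      have := isProbabilityMeasure_distLaw (p.g_lintegral k) (z k n.1)
      rw [← withDensity_apply _ measurableSet_Ici, ← p.distLaw_eq, ← compl_Iio,
        prob_compl_eq_one_iff measurableSet_Iio]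
      exact distLaw_Iio_zero _ _
    rw [hz.setLIntegral_hazard_inl]
    simp_rw [h1]
    rw [ENNReal.tsum_const_eq_top_of_ne_zero one_ne_zero]
    exact ENNReal.mul_top (by simpa using p.mbar_pos k)
  | inr k =>
    have hc : 0 < Real.pi * p.lam k := mul_pos Real.pi_pos (p.lam_pos k)
    refine ENNReal.eq_top_of_forall_nnreal_le fun x => ?_
    obtain ⟨n, hn⟩ := exists_nat_ge ((x : ℝ) / (Real.pi * p.lam k))
    have h2 : (x : ℝ≥0∞) ≤ cumHazard p (centerPP q z) (.inr k) (n + 1 : ℝ) := by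
      rw [cumHazard_inr p _ k (by positivity), ← ENNReal.ofReal_coe_nnreal]
      refine ENNReal.ofReal_le_ofReal ?_
      rw [div_le_iff₀' hc] at hn
      refine hn.trans (mul_le_mul_of_nonneg_left ?_ hc.le)
      have : (0 : ℝ) ≤ n := n.cast_nonneg
      nlinarith
    exact h2.trans (lintegral_mono_set Icc_subset_Ici_self)

end Hazard

/-! ### Frozen centres: the law of the distance to one tier -/

section FixedCenters

open Set

variable {K₁ K₂ Ω : Type*} {D : Data K₁ K₂ Ω} [MeasurableSpace Ω] {μ : Measure Ω}
  {p : Params K₁ K₂} {q : Option K₁} {z : Centers K₁}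

theorem IsModel.measurable_radius_marks (hD : IsModel p D μ) (q : Option K₁) (z : Centers K₁)
    (k : K₁ ⊕ K₂) : Measurable fun ω => radius q z (marks D ω) k := by
  cases k with
  | inl k => exact measurable_radius_inl q z (hD.size_measurable k) (hD.offset_measurable k)
  | inr k => exact measurable_radius_inr q z (hD.station_ppp k).measurable

variable [IsProbabilityMeasure μ]

theorem summable_distCDF (hz : Good p q z) (k : K₁) (r : ℝ) :
    Summable fun n : Data.ClusterIndex q k => distCDF (p.g k) r (z k n.1) :=
  ENNReal.summable_toReal (hz.summable k r)

theorem Good.toReal_cumHazard_inl (hz : Good p q z) (k : K₁) (r : ℝ) :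
    (cumHazard p (centerPP q z) (.inl k) r).toReal
      = ∑' n : Data.ClusterIndex q k, p.mbar k * distCDF (p.g k) r (z k n.1) := by
  have (n : Data.ClusterIndex q k) := isProbabilityMeasure_distLaw (p.g_lintegral k) (z k n.1)
  rw [hz.cumHazard_inl, ENNReal.toReal_mul, ENNReal.toReal_ofReal (p.mbar_pos k).le, tsum_mul_left,
    ENNReal.tsum_toReal_eq fun n => measure_ne_top _ _]
  rfl

/-- For fixed cluster centres, the survival function of the distance to a tier. -/
theorem IsModel.measure_radius (hD : IsModel p D μ) (hz : Good p q z) (k : K₁ ⊕ K₂) {r : ℝ}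
    (hr : 0 ≤ r) :
    μ {ω | ENNReal.ofReal r ≤ radius q z (marks D ω) k}
      = ENNReal.ofReal (Real.exp (-(cumHazard p (centerPP q z) k r).toReal)) := by
  cases k with
  | inl k =>
    have hset : {ω | ENNReal.ofReal r ≤ radius q z (marks D ω) (.inl k)}
        = ⋂ n : Data.ClusterIndex q k, {ω | ENNReal.ofReal r ≤
            clusterRadius (z k n.1) (D.size k n.1 ω) fun l => D.offset k n.1 l ω} := by
      ext ω
      simp only [radius, le_iInf_iff, mem_ofPred_eq, mem_iInter]
      rfl
    have hind := (hD.iIndepFun_clusterRadius k (z k)).precomp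
      (Subtype.val_injective : Function.Injective fun n : Data.ClusterIndex q k => n.1)
    have hm : ∀ n : Data.ClusterIndex q k, Measurable fun ω =>
        clusterRadius (z k n.1) (D.size k n.1 ω) fun l => D.offset k n.1 l ω := fun n =>
      measurable_clusterRadius measurable_const (hD.size_measurable k n.1)
        (hD.offset_measurable k n.1)
    rw [hset, hz.toReal_cumHazard_inl]
    refine measure_iInter_of_iIndepSet (fun n => measurableSet_le measurable_const (hm n)) ?_
      (fun n => hD.measure_clusterRadius k n.1 (z k n.1) r)
      ((summable_distCDF hz k r).mul_left _)
    rw [iIndepSet_iff_meas_biInter fun n => measurableSet_le measurable_const (hm n)]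
    exact fun s => hind.meas_biInter fun n _ => ⟨Ici (ENNReal.ofReal r), measurableSet_Ici, rfl⟩
  | inr k =>
    have hset : {ω | ENNReal.ofReal r ≤ radius q z (marks D ω) (.inr k)}
        = {ω | ∀ n, r ≤ ‖D.station k n ω‖} := by
      ext ω
      simp only [radius, le_iInf_iff, mem_ofPred_eq, ENNReal.ofReal_le_ofReal_iff (norm_nonneg _)]
      rfl
    have hc : 0 < Real.pi * p.lam k := mul_pos Real.pi_pos (p.lam_pos k)
    rw [hset, (hD.station_ppp k).void_probability (p.lam_pos k).le hr, cumHazard_inr p _ k hr,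
      ENNReal.toReal_ofReal (by positivity)]

/-- For fixed cluster centres, a tier almost surely has a point nearest to the origin. -/
theorem IsModel.ae_attained (hD : IsModel p D μ) (hz : Good p q z) (k : K₁ ⊕ K₂) :
    ∀ᵐ ω ∂μ, Attained q z (marks D ω) k := by
  have hne := measure_forall_le_eq_zero_of_survival (fun r => hz.cumHazard_ne_top k r)
    (hz.lintegral_hazard_eq_top k) fun r hr => hD.measure_radius hz k hr
  suffices hfin : ∀ N : ℕ, ∀ᵐ ω ∂μ, {x ∈ bsSet q z (marks D ω) k | ‖x‖ < N}.Finite by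
    filter_upwards [hne, ae_all_iff.2 hfin] with ω h1 h2 using attained_of_finite h1 h2
  intro N
  cases k with
  | inl k =>
    set E : Data.ClusterIndex q k → Set Ω := fun n => {ω | ENNReal.ofReal N ≤
      clusterRadius (z k n.1) (D.size k n.1 ω) fun l => D.offset k n.1 l ω}ᶜ with hE
    have hm : ∀ n : Data.ClusterIndex q k, Measurable fun ω =>
        clusterRadius (z k n.1) (D.size k n.1 ω) fun l => D.offset k n.1 l ω := fun n =>
      measurable_clusterRadius measurable_const (hD.size_measurable k n.1)
        (hD.offset_measurable k n.1)
    -- Since $1-e^{-x}\le x$, Borel–Cantelli applies: only finitely many clusters, each of finite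
    -- size, reach the disk of radius $N$.
    have hle : ∀ n, μ (E n) ≤ ENNReal.ofReal (p.mbar k) * distLaw (p.g k) (z k n.1) (Iic N) := by
      intro n
      rw [hE, prob_compl_eq_one_sub (measurableSet_le measurable_const (hm n)),
        hD.measure_clusterRadius, ← ofReal_distCDF (p.g_lintegral k), ← ENNReal.ofReal_one,
        ← ENNReal.ofReal_sub _ (Real.exp_pos _).le, ← ENNReal.ofReal_mul (p.mbar_pos k).le]
      refine ENNReal.ofReal_le_ofReal ?_
      linarith [Real.add_one_le_exp (-(p.mbar k * distCDF (p.g k) N (z k n.1)))]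
    have hsum : ∑' n, μ (E n) ≠ ∞ := by
      refine ne_top_of_le_ne_top ?_ (ENNReal.tsum_le_tsum hle)
      rw [ENNReal.tsum_mul_left]
      exact ENNReal.mul_ne_top ENNReal.ofReal_ne_top (hz.summable k N)
    filter_upwards [ae_finite_setOfPred_mem hsum] with ω hω
    refine (hω.biUnion fun n _ => (Finset.range (D.size k n.1 ω)).finite_toSet.image
      fun l => z k n.1 + D.offset k n.1 l ω).subset ?_
    rintro x ⟨⟨n, l, hl, rfl⟩, hx⟩
    refine mem_biUnion (x := n) ?_ ⟨l, Finset.mem_coe.2 (Finset.mem_range.2 hl), rfl⟩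
    intro h
    exact absurd hx (not_lt.2 (ofReal_le_clusterRadius.1 h l hl))
  | inr k =>
    filter_upwards [(hD.station_ppp k).ae_finite_norm_le N] with ω hω
    refine (hω.image fun n => D.station k n ω).subset ?_
    rintro x ⟨⟨n, rfl⟩, hx⟩
    exact ⟨n, hx.le, rfl⟩

/-- For fixed cluster centres, the law of the distance to a tier. -/
theorem IsModel.map_radius (hD : IsModel p D μ) (hz : Good p q z) (k : K₁ ⊕ K₂) :
    μ.map (fun ω => (radius q z (marks D ω) k).toReal)
      = (volume.restrict (Ici 0)).withDensity fun r => hazard p (centerPP q z) k r *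
          ENNReal.ofReal (Real.exp (-(cumHazard p (centerPP q z) k r).toReal)) := by
  refine map_eq_withDensity_of_survival (measurable_hazard_right p _ k) (hz.cumHazard_ne_top k)
    (hD.measurable_radius_marks q z k).ennreal_toReal (fun _ => ENNReal.toReal_nonneg)
    fun r hr => ?_
  refine Eq.trans ?_ (hD.measure_radius hz k hr)
  -- `toReal` sends $\infty$ to $0$, so the two survival events agree only where the radius is
  -- finite, which is almost everywhere.
  refine measure_congr ?_
  filter_upwards [hD.ae_attained hz k] with ω hω
  exact propext (ENNReal.ofReal_le_iff_le_toReal hω.radius_ne_top).symm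

theorem IsModel.measure_toReal_radius (hD : IsModel p D μ) (hz : Good p q z) (k : K₁ ⊕ K₂) {r : ℝ}
    (hr : 0 ≤ r) :
    μ {ω | r ≤ (radius q z (marks D ω) k).toReal}
      = ENNReal.ofReal (Real.exp (-(cumHazard p (centerPP q z) k r).toReal)) := by
  refine Eq.trans ?_ (hD.measure_radius hz k hr)
  refine measure_congr ?_
  filter_upwards [hD.ae_attained hz k] with ω hω
  exact propext (ENNReal.ofReal_le_iff_le_toReal hω.radius_ne_top).symm

theorem IsModel.map_radius_absolutelyContinuous (hD : IsModel p D μ) (hz : Good p q z)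
    (k : K₁ ⊕ K₂) : μ.map (fun ω => (radius q z (marks D ω) k).toReal) ≪ volume := by
  rw [hD.map_radius hz]
  exact (withDensity_absolutelyContinuous _ _).trans Measure.restrict_le_self.absolutelyContinuous

end FixedCenters

/-! ### Fubini for independent variables -/

section GenericIndependence

open Set

variable {Ω : Type*} [MeasurableSpace Ω] {μ : Measure Ω} [IsProbabilityMeasure μ]

/-- The joint law is a product, so one variable may be frozen. This serves centres against marks,
and one distance against all the others. -/
theorem measure_inter_preimage_of_indepFun {X Y : Type*} [MeasurableSpace X] [MeasurableSpace Y]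
    {f : Ω → X} {g : Ω → Y} (hf : Measurable f) (hg : Measurable g) (h : IndepFun f g μ)
    {A : Set X} (hA : MeasurableSet A) {S : Set (X × Y)} (hS : MeasurableSet S) :
    μ (f ⁻¹' A ∩ {ω | (f ω, g ω) ∈ S}) = ∫⁻ ω in f ⁻¹' A, μ {ω' | (f ω, g ω') ∈ S} ∂μ := by
  have hprod := (indepFun_iff_map_prod_eq_prod_map_map hf.aemeasurable hg.aemeasurable).1 h
  have h1 : μ (f ⁻¹' A ∩ {ω | (f ω, g ω) ∈ S})
      = (μ.map fun ω => (f ω, g ω)) (Prod.fst ⁻¹' A ∩ S) := by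
    rw [Measure.map_apply (hf.prodMk hg) ((measurable_fst hA).inter hS)]
    rfl
  have h2 : ∀ x, (μ.map g) (Prod.mk x ⁻¹' (Prod.fst ⁻¹' A ∩ S))
      = A.indicator (fun x => μ {ω' | (x, g ω') ∈ S}) x := by
    intro x
    rw [Measure.map_apply hg (measurable_prodMk_left ((measurable_fst hA).inter hS))]
    by_cases hx : x ∈ A
    · rw [indicator_of_mem hx]
      congr 1
      ext ω
      exact and_iff_right hx
    · rw [indicator_of_notMem hx]
      convert measure_empty (μ := μ)
      ext ω
      simp [hx]
  have hm : Measurable fun x => μ {ω' | (x, g ω') ∈ S} := by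
    have : (fun x => μ {ω' | (x, g ω') ∈ S}) = fun x => (μ.map g) (Prod.mk x ⁻¹' S) := by
      funext x
      rw [Measure.map_apply hg (measurable_prodMk_left hS)]
      rfl
    rw [this]
    have := Measure.isProbabilityMeasure_map (μ := μ) hg.aemeasurable
    exact measurable_measure_prodMk_left hS
  rw [h1, hprod, Measure.prod_apply ((measurable_fst hA).inter hS)]
  simp_rw [h2]
  rw [lintegral_map (hm.indicator hA) hf, ← lintegral_indicator (hf hA)]
  rfl

theorem ae_of_indepFun {X Y : Type*} [MeasurableSpace X] [MeasurableSpace Y]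
    {f : Ω → X} {g : Ω → Y} (hf : Measurable f) (hg : Measurable g) (h : IndepFun f g μ)
    {S : Set (X × Y)} (hS : MeasurableSet S)
    (hae : ∀ᵐ ω ∂μ, ∀ᵐ ω' ∂μ, (f ω, g ω') ∈ S) : ∀ᵐ ω ∂μ, (f ω, g ω) ∈ S := by
  have h1 := measure_inter_preimage_of_indepFun hf hg h MeasurableSet.univ hS.compl
  rw [preimage_univ, univ_inter, Measure.restrict_univ] at h1
  have h2 : ∫⁻ ω, μ {ω' | (f ω, g ω') ∈ Sᶜ} ∂μ = 0 := by
    rw [← lintegral_zero (μ := μ)]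
    exact lintegral_congr_ae (hae.mono fun ω hω => hω)
  rw [h2] at h1
  exact h1

/-- Independent random variables, one of which has a diffuse law, are almost surely not
proportional. -/
theorem ae_ne_mul_of_indepFun {X Y : Ω → ℝ} (hX : Measurable X) (hY : Measurable Y)
    (h : IndepFun X Y μ) (hac : μ.map Y ≪ volume) (c : ℝ) : ∀ᵐ ω ∂μ, Y ω ≠ c * X ω := by
  refine ae_of_indepFun (S := {x : ℝ × ℝ | x.2 ≠ c * x.1}) hX hY h
    (measurableSet_eq_fun (by fun_prop) (by fun_prop)).compl ?_
  refine Filter.Eventually.of_forall fun ω => ?_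
  have h0 : ∀ᵐ y : ℝ, y ≠ c * X ω := by simp [ae_iff]
  have h1 : ∀ᵐ y ∂(μ.map Y), y ≠ c * X ω := hac.ae_le h0
  exact ae_of_ae_map hY.aemeasurable h1

/-- Given $T_i=r$, the other variables keep their laws and stay independent, so the constraints
factor. -/
theorem measure_forall_mul_le_of_iIndepFun {K : Type*} [Fintype K] [DecidableEq K]
    {T : K → Ω → ℝ} (hT : ∀ k, Measurable (T k)) (h : iIndepFun T μ) (i : K) (c : K → ℝ)
    {B : Set ℝ} (hB : MeasurableSet B) :
    μ {ω | T i ω ∈ B ∧ ∀ j ∈ Finset.univ.erase i, c j * T i ω ≤ T j ω}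
      = ∫⁻ r in B, ∏ j ∈ Finset.univ.erase i, μ {ω | c j * r ≤ T j ω} ∂(μ.map (T i)) := by
  set U : Ω → ↥(Finset.univ.erase i) → ℝ := fun ω j => T j ω with hU
  have hUm : Measurable U := measurable_pi_iff.2 fun j => hT j
  have hind : IndepFun (T i) U μ := by
    have := h.indepFun_finset {i} (Finset.univ.erase i) (by simp) hT
    exact this.comp (φ := fun u : ({i} : Finset K) → ℝ => u ⟨i, by simp⟩) (ψ := id)
      (measurable_pi_apply _) measurable_id
  have hS : MeasurableSet {x : ℝ × (↥(Finset.univ.erase i) → ℝ) |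
      ∀ j, c (Subtype.val j) * x.1 ≤ x.2 j} := by
    simp only [ofPred_forall]
    exact MeasurableSet.iInter fun j => measurableSet_le (by fun_prop) (by fun_prop)
  have h1 := measure_inter_preimage_of_indepFun (hT i) hUm hind hB hS
  have h2 : ∀ r, μ {ω' | (r, U ω') ∈ {x : ℝ × (↥(Finset.univ.erase i) → ℝ) |
      ∀ j, c (Subtype.val j) * x.1 ≤ x.2 j}} = ∏ j ∈ Finset.univ.erase i,
        μ {ω | c j * r ≤ T j ω} := by
    intro r
    have h3 := h.meas_biInter (S := Finset.univ.erase i) (s := fun j => {ω | c j * r ≤ T j ω})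
      fun j _ => ⟨Ici (c j * r), measurableSet_Ici, rfl⟩
    rw [← h3]
    congr 1
    ext ω
    simp [hU]
  have hmm : Measurable fun r => ∏ j ∈ Finset.univ.erase i, μ {ω | c j * r ≤ T j ω} := by
    refine Finset.measurable_prod _ fun j _ => ?_
    have : (fun r => μ {ω | c j * r ≤ T j ω})
        = fun r => (μ.map (T j)) (Prod.mk r ⁻¹' {x : ℝ × ℝ | c j * x.1 ≤ x.2}) := by
      funext r
      rw [Measure.map_apply (hT j) (measurable_prodMk_left
        (measurableSet_le (by fun_prop) (by fun_prop)))]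
      rfl
    rw [this]
    have := Measure.isProbabilityMeasure_map (μ := μ) (hT j).aemeasurable
    exact measurable_measure_prodMk_left (measurableSet_le (by fun_prop) (by fun_prop))
  rw [setLIntegral_map hB hmm (hT i)]
  simp only [h2] at h1
  rw [← h1]
  congr 1
  ext ω
  simp [hU]

end GenericIndependence

/-! ### Power ratios -/

section Params

variable {K₁ K₂ : Type*}

theorem Params.Pbar_pos (p : Params K₁ K₂) (j i : K₁ ⊕ K₂) : 0 < p.Pbar j i :=
  Real.rpow_pos_of_pos (div_pos (p.P_pos j) (p.P_pos i)) _

theorem Params.Pbar_self (p : Params K₁ K₂) (i : K₁ ⊕ K₂) : p.Pbar i i = 1 := by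
  rw [Params.Pbar, div_self (p.P_pos i).ne', Real.one_rpow]

/-- A transmitter of tier $i$ at distance $s$ is received like one of tier $j$ at distance $\bar
P_{j,i}s$. Comparison of powers thus reduces to comparison of distances. -/
theorem Params.power_eq (p : Params K₁ K₂) (j i : K₁ ⊕ K₂) {s : ℝ} (hs : 0 ≤ s) :
    p.P i * s ^ (-p.α) = p.P j * (p.Pbar j i * s) ^ (-p.α) := by
  have hα : p.α ≠ 0 := by linarith [p.two_lt_α]
  have hd : 0 < p.P j / p.P i := div_pos (p.P_pos j) (p.P_pos i)
  rw [Real.mul_rpow (p.Pbar_pos j i).le hs, Params.Pbar, ← Real.rpow_mul hd.le,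
    show 1 / p.α * -p.α = -1 by field_simp, Real.rpow_neg_one, inv_div]
  have := (p.P_pos j).ne'
  field_simp

end Params

/-! ### Frozen centres: association density and absence of ties -/

section FixedCenters

open Set

variable {K₁ K₂ Ω : Type*} [Fintype K₁] [Fintype K₂] {D : Data K₁ K₂ Ω} [MeasurableSpace Ω]
  {μ : Measure Ω} [IsProbabilityMeasure μ] {p : Params K₁ K₂} {q : Option K₁} {z : Centers K₁}

/-- Given the parent point processes, the density of the serving distance on the association event
of tier `i`. -/
noncomputable def assocDensity (p : Params K₁ K₂) (i : K₁ ⊕ K₂) (φ : K₁ → Measure Plane) (r : ℝ) :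
    ℝ≥0∞ :=
  hazard p φ i r *
    ∏ j, ENNReal.ofReal (Real.exp (-(cumHazard p φ j (p.Pbar j i * r)).toReal))

theorem measurable_assocDensity (p : Params K₁ K₂) (i : K₁ ⊕ K₂) :
    Measurable fun x : (K₁ → Measure Plane) × ℝ => assocDensity p i x.1 x.2 := by
  refine (measurable_hazard p i).mul (Finset.measurable_prod _ fun j _ => ?_)
  have := (measurable_cumHazard p j).comp (f := fun x : (K₁ → Measure Plane) × ℝ =>
    (x.1, p.Pbar j i * x.2)) (by fun_prop)
  exact this.ennreal_toReal.neg.exp.ennreal_ofReal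

/-- For fixed cluster centres, the joint law of the association event and the serving distance. -/
theorem IsModel.measure_assoc_radius (hD : IsModel p D μ) (hz : Good p q z) (i : K₁ ⊕ K₂)
    {B : Set ℝ} (hB : MeasurableSet B) :
    μ {ω | (radius q z (marks D ω) i).toReal ∈ B ∧ ∀ j, j ≠ i →
        p.Pbar j i * (radius q z (marks D ω) i).toReal ≤ (radius q z (marks D ω) j).toReal}
      = ∫⁻ r in B, assocDensity p i (centerPP q z) r ∂(volume.restrict (Ici 0)) := by
  classical
  have hm : ∀ k, Measurable fun ω => (radius q z (marks D ω) k).toReal := fun k =>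
    (hD.measurable_radius_marks q z k).ennreal_toReal
  have hind := (hD.iIndepFun_radius q z).comp (fun _ => ENNReal.toReal)
    fun _ => ENNReal.measurable_toReal
  have h1 := measure_forall_mul_le_of_iIndepFun hm hind i (fun j => p.Pbar j i) hB
  simp only [Finset.mem_erase, Finset.mem_univ, and_true] at h1
  rw [h1]
  have h2 : ∫⁻ r in B, ∏ j ∈ Finset.univ.erase i,
        μ {ω | p.Pbar j i * r ≤ (radius q z (marks D ω) j).toReal}
        ∂(μ.map fun ω => (radius q z (marks D ω) i).toReal)
      = ∫⁻ r in B, ∏ j ∈ Finset.univ.erase i,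
        ENNReal.ofReal (Real.exp (-(cumHazard p (centerPP q z) j (p.Pbar j i * r)).toReal))
        ∂(μ.map fun ω => (radius q z (marks D ω) i).toReal) := by
    refine lintegral_congr_ae (ae_restrict_of_ae ?_)
    have h0 : ∀ᵐ r ∂(μ.map fun ω => (radius q z (marks D ω) i).toReal), 0 ≤ r := by
      rw [ae_map_iff (hm i).aemeasurable measurableSet_Ici]
      exact Filter.Eventually.of_forall fun _ => ENNReal.toReal_nonneg
    filter_upwards [h0] with r hr
    exact Finset.prod_congr rfl fun j _ =>
      hD.measure_toReal_radius hz j (mul_nonneg (p.Pbar_pos j i).le hr)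
  have hsm : ∀ j, Measurable fun r =>
      ENNReal.ofReal (Real.exp (-(cumHazard p (centerPP q z) j r).toReal)) := fun j =>
    ((measurable_cumHazard p j).comp measurable_prodMk_left).ennreal_toReal.neg.exp.ennreal_ofReal
  have hpm : Measurable fun r => ∏ j ∈ Finset.univ.erase i,
      ENNReal.ofReal (Real.exp (-(cumHazard p (centerPP q z) j (p.Pbar j i * r)).toReal)) :=
    Finset.measurable_prod _ fun j _ => (hsm j).comp (measurable_const_mul (p.Pbar j i))
  have hdm : Measurable fun r => hazard p (centerPP q z) i r *
      ENNReal.ofReal (Real.exp (-(cumHazard p (centerPP q z) i r).toReal)) :=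
    (measurable_hazard_right p _ i).mul (hsm i)
  rw [h2, hD.map_radius hz i, setLIntegral_withDensity_eq_setLIntegral_mul _ hdm hpm hB]
  congr 1 with r
  -- The survival factor in the density of $R_i$ is the missing term $j=i$, because $\bar
  -- P_{i,i}=1$.
  rw [assocDensity, ← Finset.mul_prod_erase _ _ (Finset.mem_univ i), Pi.mul_apply, p.Pbar_self,
    one_mul, mul_assoc]

/-- The distances to the tiers are positive, attained, and without ties in received power or
distance. -/
structure Regular (p : Params K₁ K₂) (q : Option K₁) (z : Centers K₁) (w : Marks K₁ K₂) :
    Prop where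
  attained : ∀ k, Attained q z w k
  ne_zero : ∀ k, (radius q z w k).toReal ≠ 0
  ne_mul : ∀ i j, j ≠ i → (radius q z w j).toReal ≠ p.Pbar j i * (radius q z w i).toReal
  ne : ∀ i j, j ≠ i → (radius q z w j).toReal ≠ 1 * (radius q z w i).toReal

theorem measurableSet_regular (p : Params K₁ K₂) (q : Option K₁) :
    MeasurableSet {x : Centers K₁ × Marks K₁ K₂ | Regular p q x.1 x.2} := by
  have hm : ∀ k : K₁ ⊕ K₂, Measurable fun x : Centers K₁ × Marks K₁ K₂ =>
      (radius q x.1 x.2 k).toReal := fun k => (measurable_radius k).ennreal_toReal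
  have h : {x : Centers K₁ × Marks K₁ K₂ | Regular p q x.1 x.2}
      = (⋂ k, {x | Attained q x.1 x.2 k}) ∩ (⋂ k, {x | (radius q x.1 x.2 k).toReal = 0}ᶜ)
        ∩ (⋂ (i) (j) (_ : j ≠ i),
          {x | (radius q x.1 x.2 j).toReal = p.Pbar j i * (radius q x.1 x.2 i).toReal}ᶜ)
        ∩ (⋂ (i) (j) (_ : j ≠ i),
          {x | (radius q x.1 x.2 j).toReal = 1 * (radius q x.1 x.2 i).toReal}ᶜ) := by
    ext x
    simp only [mem_ofPred_eq, mem_inter_iff, mem_iInter, mem_compl_iff]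
    exact ⟨fun h => ⟨⟨⟨h.1, h.2⟩, h.3⟩, h.4⟩, fun h => ⟨h.1.1.1, h.1.1.2, h.1.2, h.2⟩⟩
  rw [h]
  refine (((MeasurableSet.iInter fun k => measurableSet_attained k).inter
    (MeasurableSet.iInter fun k => ?_)).inter ?_).inter ?_
  · exact (measurableSet_eq_fun (hm k) measurable_const).compl
  · exact MeasurableSet.iInter fun i => MeasurableSet.iInter fun j => MeasurableSet.iInter fun _ =>
      (measurableSet_eq_fun (hm j) ((hm i).const_mul _)).compl
  · exact MeasurableSet.iInter fun i => MeasurableSet.iInter fun j => MeasurableSet.iInter fun _ =>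
      (measurableSet_eq_fun (hm j) ((hm i).const_mul _)).compl

/-- Each distance has an absolutely continuous law and is independent of every other, so it almost
surely avoids $0$ and any fixed multiple of another distance. The multiples $\bar P_{j,i}$ and $1$
exclude ties in power and in distance. -/
theorem IsModel.ae_regular_of_good (hD : IsModel p D μ) (hz : Good p q z) :
    ∀ᵐ ω ∂μ, Regular p q z (marks D ω) := by
  have hm : ∀ k, Measurable fun ω => (radius q z (marks D ω) k).toReal := fun k =>
    (hD.measurable_radius_marks q z k).ennreal_toReal
  have hind := (hD.iIndepFun_radius q z).comp (fun _ => ENNReal.toReal)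
    fun _ => ENNReal.measurable_toReal
  have htie : ∀ (c : K₁ ⊕ K₂ → K₁ ⊕ K₂ → ℝ), ∀ᵐ ω ∂μ, ∀ i j, j ≠ i →
      (radius q z (marks D ω) j).toReal ≠ c j i * (radius q z (marks D ω) i).toReal := by
    intro c
    simp only [ae_all_iff]
    intro i j hij
    exact ae_ne_mul_of_indepFun (hm i) (hm j) (hind.indepFun hij.symm)
      (hD.map_radius_absolutelyContinuous hz j) _
  have hzero : ∀ᵐ ω ∂μ, ∀ k, (radius q z (marks D ω) k).toReal ≠ 0 := by
    rw [ae_all_iff]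
    intro k
    have h0 : ∀ᵐ y : ℝ, y ≠ 0 := by simp [ae_iff]
    have h1 : ∀ᵐ y ∂(μ.map fun ω => (radius q z (marks D ω) k).toReal), y ≠ 0 :=
      (hD.map_radius_absolutelyContinuous hz k).ae_le h0
    exact ae_of_ae_map (hm k).aemeasurable h1
  filter_upwards [ae_all_iff.2 (hD.ae_attained hz), hzero, htie p.Pbar, htie fun _ _ => 1]
    with ω h1 h2 h3 h4 using ⟨h1, h2, h3, h4⟩

end FixedCenters

/-! ### Random centres: regularity and comparison of received powers -/

section RandomCenters

open Set

theorem measurable_centerPP {K₁ : Type*} (q : Option K₁) : Measurable (centerPP (K₁ := K₁) q) := by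
  refine measurable_pi_iff.2 fun k => Measure.measurable_of_measurable_coe _ fun s hs => ?_
  simp_rw [centerPP, pointMeasure_apply _ _ hs]
  exact Measurable.tsum fun n => (measurable_one.indicator hs).comp (by fun_prop)

variable {K₁ K₂ Ω : Type*} {D : Data K₁ K₂ Ω}

theorem parentPP_eq (q : Option K₁) (ω : Ω) : D.parentPP q ω = centerPP q (centers D ω) := rfl

/-- The distance from the origin to tier `k`. -/
noncomputable def tierDist (q : Option K₁) (D : Data K₁ K₂ Ω) (k : K₁ ⊕ K₂) (ω : Ω) : ℝ :=
  (radius q (centers D ω) (marks D ω) k).toReal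

theorem norm_candidate {p : Params K₁ K₂} {q : Option K₁} {ω : Ω}
    (h : Regular p q (centers D ω) (marks D ω)) (k : K₁ ⊕ K₂) :
    ‖candidate q D k ω‖ = tierDist q D k ω := by
  rw [candidate, stations_eq_bsSet]
  exact (h.attained k).norm_nearest

/-- The negative exponent reverses the order, which requires positive distances. -/
theorem candidatePower_le_iff {p : Params K₁ K₂} {q : Option K₁} {ω : Ω}
    (h : Regular p q (centers D ω) (marks D ω))
    (j i : K₁ ⊕ K₂) :
    candidatePower p q D j ω ≤ candidatePower p q D i ω ↔
      p.Pbar j i * tierDist q D i ω ≤ tierDist q D j ω := by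
  have hpos : ∀ k, 0 < tierDist q D k ω := fun k =>
    lt_of_le_of_ne ENNReal.toReal_nonneg (h.ne_zero k).symm
  rw [candidatePower, candidatePower, norm_candidate h, norm_candidate h,
    p.power_eq j i (hpos i).le, mul_le_mul_iff_right₀ (p.P_pos j),
    Real.rpow_le_rpow_iff_of_neg (hpos j) (mul_pos (p.Pbar_pos j i) (hpos i))
      (by linarith [p.two_lt_α])]

theorem candidatePower_ne {p : Params K₁ K₂} {q : Option K₁} {ω : Ω}
    (h : Regular p q (centers D ω) (marks D ω))
    {j i : K₁ ⊕ K₂} (hji : j ≠ i) : candidatePower p q D j ω ≠ candidatePower p q D i ω := by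
  have hpos : ∀ k, 0 < tierDist q D k ω := fun k =>
    lt_of_le_of_ne ENNReal.toReal_nonneg (h.ne_zero k).symm
  intro heq
  rw [candidatePower, candidatePower, norm_candidate h, norm_candidate h,
    p.power_eq j i (hpos i).le] at heq
  have h1 := mul_left_cancel₀ (p.P_pos j).ne' heq
  have hα : -p.α ≠ 0 := by linarith [p.two_lt_α]
  exact h.ne_mul i j hji
    ((Real.rpow_left_inj (hpos j).le (mul_pos (p.Pbar_pos j i) (hpos i)).le hα).1 h1)

variable [MeasurableSpace Ω] {μ : Measure Ω} {p : Params K₁ K₂}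

theorem IsModel.measurable_tierDist (hD : IsModel p D μ) (q : Option K₁) (k : K₁ ⊕ K₂) :
    Measurable (tierDist q D k) :=
  ((measurable_radius k).comp (hD.measurable_centers.prodMk hD.measurable_marks)).ennreal_toReal

theorem IsModel.measurable_parentPP (hD : IsModel p D μ) (q : Option K₁) :
    Measurable (D.parentPP q) :=
  (measurable_centerPP q).comp (f := centers D) hD.measurable_centers

/-- By Campbell's formula, $\sum_{\mathbf z}F(N\mid\mathbf z)$ over the parent Poisson process has
mean $\lambda_{\mathrm p}\pi N^2$, hence is almost surely finite. A possible $\mathbf z_0$ adds a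
single finite term, and integer radii suffice by monotonicity. -/
theorem IsModel.ae_good [Finite K₁] (hD : IsModel p D μ) (q : Option K₁) :
    ∀ᵐ ω ∂μ, Good p q (centers D ω) := by
  have h1 : ∀ᵐ ω ∂μ, ∀ (k : K₁) (N : ℕ), {n | ‖D.parent k n ω‖ ≤ N}.Finite := by
    simp only [ae_all_iff]
    exact fun k N => (hD.parent_ppp k).ae_finite_norm_le N
  have hmeas : ∀ (k : K₁) (N : ℕ), Measurable fun z => distLaw (p.g k) z (Iic (N : ℝ)) := by
    intro k N
    simp_rw [distLaw_Iic (p.g k) _ (p.distLaw_eq k _)]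
    exact (measurable_lintegral_Icc (p.measurable_density k)).comp measurable_prodMk_right
  have h2 : ∀ᵐ ω ∂μ, ∀ (k : K₁) (N : ℕ),
      ∑' n, distLaw (p.g k) (D.parent k n ω) (Iic (N : ℝ)) < ∞ := by
    simp only [ae_all_iff]
    intro k N
    have hm : ∀ n, Measurable fun ω => distLaw (p.g k) (D.parent k n ω) (Iic (N : ℝ)) := fun n =>
      (hmeas k N).comp ((hD.parent_ppp k).measurable n)
    refine ae_lt_top (Measurable.tsum hm) ?_
    rw [lintegral_tsum fun n => (hm n).aemeasurable,
      (hD.parent_ppp k).tsum_lintegral (hmeas k N),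
      lintegral_distLaw_Iic (p.g_lintegral k) N.cast_nonneg]
    exact ENNReal.mul_ne_top ENNReal.ofReal_ne_top ENNReal.ofReal_ne_top
  filter_upwards [h1, h2] with ω h1 h2
  refine ⟨fun k N => ?_, fun k r => ?_⟩
  · have hA : MeasurableSet {x : Plane | ‖x‖ ≤ N} :=
    measurableSet_le measurable_norm measurable_const
    have hfin : {n : Data.ClusterIndex q k | ‖D.center k n.1 ω‖ ≤ N}.Finite := by
      refine Set.Finite.of_finite_image (f := Subtype.val) ?_ Subtype.val_injective.injOn
      refine (((h1 k N).image some).insert none).subset ?_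
      rintro _ ⟨⟨n, hn⟩, hle, rfl⟩
      cases n with
      | none => exact mem_insert _ _
      | some n => exact mem_insert_of_mem _ ⟨n, hle, rfl⟩
    rw [centerPP, pointMeasure_apply _ _ hA, tsum_eq_sum (s := hfin.toFinset)]
    · refine ENNReal.sum_ne_top.2 fun n _ => ?_
      rw [indicator_apply]
      split_ifs <;> simp
    · intro n hn
      exact indicator_of_notMem (s := {x : Plane | ‖x‖ ≤ N}) (f := (1 : Plane → ℝ≥0∞))
        fun h => hn (hfin.mem_toFinset.2 h)
  · obtain ⟨N, hN⟩ := exists_nat_ge r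
    have (z : Plane) := isProbabilityMeasure_distLaw (p.g_lintegral k) z
    have h3 : ∑' n : Option ℕ, distLaw (p.g k) (D.center k n ω) (Iic (N : ℝ)) ≠ ∞ := by
      rw [← (Equiv.optionEquivSumPUnit.{0} ℕ).symm.tsum_eq,
        Summable.tsum_sum ENNReal.summable ENNReal.summable]
      refine ENNReal.add_ne_top.2 ⟨(h2 k N).ne, ?_⟩
      rw [tsum_fintype]
      exact ENNReal.sum_ne_top.2 fun _ _ => measure_ne_top _ _
    refine ne_top_of_le_ne_top h3 ?_
    refine (ENNReal.tsum_le_tsum fun n => measure_mono (Iic_subset_Iic.2 hN)).trans ?_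
    exact ENNReal.tsum_comp_le_tsum_of_injective (Subtype.val_injective (p := fun n : Option ℕ =>
      n = none → q = some k)) fun n => distLaw (p.g k) (D.center k n ω) (Iic (N : ℝ))

end RandomCenters

/-! ### Joint law of parents, association and distance -/

section TierDistances

open Set

variable {K₁ K₂ Ω : Type*} [Fintype K₁] [Fintype K₂] {D : Data K₁ K₂ Ω} [MeasurableSpace Ω]
  {μ : Measure Ω} {p : Params K₁ K₂}

/-- The tier `i` provides the largest average received power. -/
def distAssoc (p : Params K₁ K₂) (q : Option K₁) (D : Data K₁ K₂ Ω) (i : K₁ ⊕ K₂) : Set Ω :=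
  {ω | ∀ j, j ≠ i → p.Pbar j i * tierDist q D i ω ≤ tierDist q D j ω}

theorem IsModel.measurableSet_distAssoc (hD : IsModel p D μ) (q : Option K₁) (i : K₁ ⊕ K₂) :
    MeasurableSet (distAssoc p q D i) := by
  simp only [distAssoc, ofPred_forall]
  exact MeasurableSet.iInter fun j => MeasurableSet.iInter fun _ => measurableSet_le
    ((hD.measurable_tierDist q i).const_mul _) (hD.measurable_tierDist q j)

variable [IsProbabilityMeasure μ]

theorem IsModel.ae_regular (hD : IsModel p D μ) (q : Option K₁) :
    ∀ᵐ ω ∂μ, Regular p q (centers D ω) (marks D ω) :=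
  ae_of_indepFun hD.measurable_centers hD.measurable_marks hD.indepFun_centers_marks
    (measurableSet_regular p q) ((hD.ae_good q).mono fun _ hω => hD.ae_regular_of_good hω)

/-- The joint law of the parent point processes, the association event and the serving distance. -/
theorem IsModel.measure_parentPP_inter (hD : IsModel p D μ) (q : Option K₁) (i : K₁ ⊕ K₂)
    {C : Set (K₁ → Measure Plane)} (hC : MeasurableSet C) {B : Set ℝ} (hB : MeasurableSet B) :
    μ (D.parentPP q ⁻¹' C ∩ (distAssoc p q D i ∩ tierDist q D i ⁻¹' B))
      = ∫⁻ ω in D.parentPP q ⁻¹' C,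
          ∫⁻ r in B, assocDensity p i (D.parentPP q ω) r ∂(volume.restrict (Ici 0)) ∂μ := by
  have hm : ∀ k : K₁ ⊕ K₂, Measurable fun x : Centers K₁ × Marks K₁ K₂ =>
      (radius q x.1 x.2 k).toReal := fun k => (measurable_radius k).ennreal_toReal
  have hS : MeasurableSet {x : Centers K₁ × Marks K₁ K₂ | (radius q x.1 x.2 i).toReal ∈ B ∧
      ∀ j, j ≠ i → p.Pbar j i * (radius q x.1 x.2 i).toReal ≤ (radius q x.1 x.2 j).toReal} := by
    suffices h : MeasurableSet {x : Centers K₁ × Marks K₁ K₂ | ∀ j, j ≠ i →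
        p.Pbar j i * (radius q x.1 x.2 i).toReal ≤ (radius q x.1 x.2 j).toReal} from
      (hm i hB).inter h
    simp only [ofPred_forall]
    exact MeasurableSet.iInter fun j => MeasurableSet.iInter fun _ =>
      measurableSet_le ((hm i).const_mul _) (hm j)
  have h1 := measure_inter_preimage_of_indepFun hD.measurable_centers hD.measurable_marks
    hD.indepFun_centers_marks (measurable_centerPP q hC) hS
  have h2 : D.parentPP q ⁻¹' C ∩ (distAssoc p q D i ∩ tierDist q D i ⁻¹' B)
      = centers D ⁻¹' (centerPP q ⁻¹' C) ∩ {ω | (centers D ω, marks D ω) ∈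
        {x : Centers K₁ × Marks K₁ K₂ | (radius q x.1 x.2 i).toReal ∈ B ∧
      ∀ j, j ≠ i → p.Pbar j i * (radius q x.1 x.2 i).toReal ≤ (radius q x.1 x.2 j).toReal}} := by
    ext ω
    exact and_congr_right fun _ => and_comm
  rw [h2, h1]
  -- Inside the integral the centres are frozen, so the computation for good configurations applies
  -- for almost every $\omega$.
  refine lintegral_congr_ae (ae_restrict_of_ae ?_)
  filter_upwards [hD.ae_good q] with ω hω
  exact hD.measure_assoc_radius hω i hB

end TierDistances

/-! ### Association by power and association by distance -/

section Association

variable {K₁ K₂ Ω : Type*} [Fintype K₁] [Fintype K₂] [Nonempty (K₁ ⊕ K₂)] {D : Data K₁ K₂ Ω}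
  {p : Params K₁ K₂} {q : Option K₁}

/-- Association is an equality of points, so two tiers could share the serving point. Distinct
distances exclude this and identify the serving tier; distinct powers make the maximizer unique for
the converse. -/
theorem mem_assoc_iff {ω : Ω} (h : Regular p q (centers D ω) (marks D ω)) (i : K₁ ⊕ K₂) :
    ω ∈ assoc p q D i ↔ ω ∈ distAssoc p q D i := by
  have hmax : ∀ k, candidatePower p q D k ω ≤ candidatePower p q D (servingTier p q D ω) ω :=
    (Finite.exists_max fun k => candidatePower p q D k ω).choose_spec
  constructor
  · intro (hω : candidate q D (servingTier p q D ω) ω = candidate q D i ω)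
    have hi : servingTier p q D ω = i := by
      by_contra hne
      have h1 := congrArg norm hω
      rw [norm_candidate h, norm_candidate h] at h1
      exact h.ne i _ hne (by rw [one_mul]; exact h1)
    intro j _
    rw [← candidatePower_le_iff h]
    exact hi ▸ hmax j
  · intro hω
    have hi : servingTier p q D ω = i := by
      by_contra hne
      exact candidatePower_ne h hne
        (le_antisymm ((candidatePower_le_iff h _ i).2 (hω _ hne)) (hmax i))
    change candidate q D (servingTier p q D ω) ω = candidate q D i ω
    rw [hi]

theorem IsModel.assoc_ae_eq [MeasurableSpace Ω] {μ : Measure Ω} [IsProbabilityMeasure μ]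
    (hD : IsModel p D μ) (q : Option K₁) (i : K₁ ⊕ K₂) :
    assoc p q D i =ᵐ[μ] distAssoc p q D i := by
  filter_upwards [hD.ae_regular q] with ω hω
  exact propext (mem_assoc_iff hω i)

end Association

/-! ### Agreement with the stated integrand -/

section Integrand

open Set

variable {K₁ K₂ Ω : Type*} [Fintype K₁] [Fintype K₂] {D : Data K₁ K₂ Ω} {p : Params K₁ K₂}
  {q : Option K₁}

/-- Summability of the exponents turns the infinite product of exponentials into the exponential of
their sum. -/
theorem voidFactor_eq {ω : Ω} (hz : Good p q (centers D ω)) (i : K₁ ⊕ K₂) {r : ℝ} (hr : 0 ≤ r) :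
    voidFactor p q D i ω r
      = ∏ j, Real.exp (-(cumHazard p (D.parentPP q ω) j (p.Pbar j i * r)).toReal) := by
  rw [Fintype.prod_sum_type, voidFactor, parentPP_eq]
  congr 1
  · refine Finset.prod_congr rfl fun k _ => ?_
    rw [hz.toReal_cumHazard_inl]
    exact (((summable_distCDF hz k (p.Pbar (.inl k) i * r)).mul_left
      (p.mbar k)).hasSum.neg.rexp).tprod_eq
  · refine Finset.prod_congr rfl fun k _ => ?_
    have := p.lam_pos k
    have := Real.pi_pos
    rw [cumHazard_inr p _ k (mul_nonneg (p.Pbar_pos _ i).le hr), ENNReal.toReal_ofReal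
      (by positivity)]
    congr 2
    ring

/-- `distPDF` is a Radon–Nikodym derivative chosen separately for each centre, so it matches the
jointly measurable density only almost everywhere. The centres are countable, so one null set of
radii is enough. -/
theorem assocIntegrand_ae_eq {ω : Ω} (hz : Good p q (centers D ω)) (i : K₁ ⊕ K₂) :
    ∀ᵐ r ∂(volume.restrict (Ici (0 : ℝ))),
      assocIntegrand p q D i ω r = assocDensity p i (D.parentPP q ω) r := by
  have hV : ∀ r : ℝ, 0 ≤ r → ENNReal.ofReal (voidFactor p q D i ω r)
      = ∏ j, ENNReal.ofReal
        (Real.exp (-(cumHazard p (D.parentPP q ω) j (p.Pbar j i * r)).toReal)) := fun r hr => by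
    rw [voidFactor_eq hz i hr, ENNReal.ofReal_prod_of_nonneg fun _ _ => (Real.exp_pos _).le]
  cases i with
  | inl k =>
    have h1 : ∀ᵐ r : ℝ, ∀ n : Data.ClusterIndex q k,
        distPDF (p.g k) r (D.center k n.1 ω) = p.density k (D.center k n.1 ω, r) := by
      rw [ae_all_iff]
      exact fun n => distPDF_ae_eq _ ((p.measurable_density k).comp measurable_prodMk_left)
        (p.distLaw_eq k _)
    filter_upwards [ae_restrict_of_ae h1, ae_restrict_mem measurableSet_Ici] with r h1 hr
    rw [assocIntegrand, assocDensity, hV r hr, parentPP_eq, hz.hazard_inl]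
    simp_rw [h1]
    rfl
  | inr k =>
    filter_upwards [ae_restrict_mem measurableSet_Ici] with r hr
    have := p.lam_pos k
    have := Real.pi_pos
    rw [assocIntegrand, assocDensity, ← hV r hr, hazard, ← ENNReal.ofReal_mul
      (by have : 0 ≤ r := hr; positivity)]
    congr 1
    ring

end Integrand

/-! ### Conditional probability and conditional law given the parents -/

section Conditioning

open Set

variable {K₁ K₂ Ω : Type*} [Fintype K₁] [Fintype K₂] {D : Data K₁ K₂ Ω} [MeasurableSpace Ω]
  {μ : Measure Ω} [IsProbabilityMeasure μ] {p : Params K₁ K₂}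

/-- The conditional association probability as a function of the parent point processes. -/
noncomputable def assocMass (p : Params K₁ K₂) (i : K₁ ⊕ K₂) (φ : K₁ → Measure Plane) : ℝ≥0∞ :=
  ∫⁻ r, assocDensity p i φ r ∂(volume.restrict (Ici 0))

theorem measurable_assocMass (p : Params K₁ K₂) (i : K₁ ⊕ K₂) : Measurable (assocMass p i) :=
  (measurable_assocDensity p i).lintegral_prod_right'

theorem measurable_assocDensity_right (p : Params K₁ K₂) (i : K₁ ⊕ K₂) (φ : K₁ → Measure Plane) :
    Measurable (assocDensity p i φ) :=
  (measurable_assocDensity p i).comp measurable_prodMk_left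

/-- For frozen centres the mass is a probability. -/
theorem IsModel.assocMass_le_one (hD : IsModel p D μ) {q : Option K₁} {z : Centers K₁}
    (hz : Good p q z) (i : K₁ ⊕ K₂) : assocMass p i (centerPP q z) ≤ 1 := by
  rw [assocMass, ← setLIntegral_univ, ← hD.measure_assoc_radius hz i MeasurableSet.univ]
  exact prob_le_one

/-- The survival factors never vanish, so zero mass would force the hazard to vanish almost
everywhere, against its infinite integral. -/
theorem Good.assocMass_ne_zero {q : Option K₁} {z : Centers K₁} (hz : Good p q z) (i : K₁ ⊕ K₂) :
    assocMass p i (centerPP q z) ≠ 0 := by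
  intro h
  rw [assocMass, lintegral_eq_zero_iff (measurable_assocDensity_right p i _)] at h
  have h1 : ∫⁻ r in Ici 0, hazard p (centerPP q z) i r = 0 := by
    rw [lintegral_eq_zero_iff (measurable_hazard_right p _ i)]
    filter_upwards [h] with r hr
    refine (mul_eq_zero.1 hr).resolve_right (Finset.prod_ne_zero_iff.2 fun j _ => ?_)
    simpa using Real.exp_pos _
  rw [hz.lintegral_hazard_eq_top i] at h1
  exact ENNReal.top_ne_zero h1

/-- Every set of the parent σ-algebra is a preimage under `D.parentPP q`, so the joint law with an
unrestricted distance gives the defining integrals of the conditional expectation. -/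
theorem IsModel.condExp_distAssoc (hD : IsModel p D μ) (q : Option K₁) (i : K₁ ⊕ K₂) :
    (fun ω => (assocMass p i (D.parentPP q ω)).toReal)
      =ᵐ[μ] μ⟦distAssoc p q D i | D.parentSigma q⟧ := by
  have hle : D.parentSigma q ≤ ‹MeasurableSpace Ω› := (hD.measurable_parentPP q).comap_le
  have hm : Measurable fun ω => assocMass p i (D.parentPP q ω) :=
    (measurable_assocMass p i).comp (hD.measurable_parentPP q)
  have hle1 : ∀ᵐ ω ∂μ, assocMass p i (D.parentPP q ω) ≤ 1 := by
    filter_upwards [hD.ae_good q] with ω hω using hD.assocMass_le_one hω i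
  have hfin : ∫⁻ ω, assocMass p i (D.parentPP q ω) ∂μ ≠ ∞ := by
    refine ne_top_of_le_ne_top ENNReal.one_ne_top ((lintegral_mono_ae hle1).trans ?_)
    simp
  have hS := hD.measurableSet_distAssoc q i
  refine ae_eq_condExp_of_forall_setIntegral_eq hle
    ((integrable_const (1 : ℝ)).indicator hS) (fun s _ _ =>
      (integrable_toReal_of_lintegral_ne_top hm.aemeasurable hfin).integrableOn) ?_ ?_
  · rintro s ⟨C, hC, rfl⟩ -
    have h1 := hD.measure_parentPP_inter q i hC MeasurableSet.univ
    rw [preimage_univ, inter_univ] at h1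
    simp only [Measure.restrict_univ] at h1
    rw [integral_toReal hm.aemeasurable
      (ae_restrict_of_ae (hle1.mono fun _ h => h.trans_lt ENNReal.one_lt_top)),
      integral_indicator_const _ hS, smul_eq_mul, mul_one, measureReal_restrict_apply hS,
      measureReal_def, inter_comm, h1]
    rfl
  · refine Measurable.aestronglyMeasurable ?_
    exact ((measurable_assocMass p i).comp (comap_measurable (D.parentPP q))).ennreal_toReal

/-- The law of the parent point processes on the association event. -/
theorem IsModel.map_restrict_distAssoc (hD : IsModel p D μ) (q : Option K₁) (i : K₁ ⊕ K₂) :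
    (μ.restrict (distAssoc p q D i)).map (D.parentPP q)
      = (μ.map (D.parentPP q)).withDensity (assocMass p i) := by
  ext C hC
  have hX := hD.measurable_parentPP q
  have h1 := hD.measure_parentPP_inter q i hC MeasurableSet.univ
  rw [preimage_univ, inter_univ] at h1
  simp only [Measure.restrict_univ] at h1
  rw [Measure.map_apply hX hC, Measure.restrict_apply (hX hC), h1, withDensity_apply _ hC,
    setLIntegral_map hC (measurable_assocMass p i) hX]
  rfl

/-- The conditional law of the serving distance as a kernel from the parent point processes. -/
noncomputable def servingKernel (p : Params K₁ K₂) (i : K₁ ⊕ K₂) :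
    Kernel (K₁ → Measure Plane) ℝ :=
  (Kernel.const _ (volume.restrict (Ici 0))).withDensity
    fun φ r => assocDensity p i φ r * (assocMass p i φ)⁻¹

theorem servingKernel_apply (p : Params K₁ K₂) (i : K₁ ⊕ K₂) (φ : K₁ → Measure Plane) :
    servingKernel p i φ = (volume.restrict (Ici 0)).withDensity
      fun r => assocDensity p i φ r * (assocMass p i φ)⁻¹ := by
  rw [servingKernel, Kernel.withDensity_apply, Kernel.const_apply]
  exact (measurable_assocDensity p i).mul ((measurable_assocMass p i).comp measurable_fst).inv

theorem servingKernel_apply_set (p : Params K₁ K₂) (i : K₁ ⊕ K₂) (φ : K₁ → Measure Plane)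
    {B : Set ℝ} (hB : MeasurableSet B) :
    servingKernel p i φ B
      = (∫⁻ r in B, assocDensity p i φ r ∂(volume.restrict (Ici 0))) * (assocMass p i φ)⁻¹ := by
  rw [servingKernel_apply, withDensity_apply _ hB, lintegral_mul_const _
    (measurable_assocDensity_right p i φ)]

/-- In `ℝ≥0∞`, $a\cdot a^{-1}\le 1$ also for $a=0$ and $a=\infty$, so no restriction on the
configuration is needed. -/
instance (p : Params K₁ K₂) (i : K₁ ⊕ K₂) : IsFiniteKernel (servingKernel p i) := by
  refine ⟨1, ENNReal.one_lt_top, fun φ => ?_⟩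
  rw [servingKernel_apply_set p i φ MeasurableSet.univ, setLIntegral_univ]
  exact ENNReal.mul_inv_le_one _

/-- Restricting to the association event weights the parents by `assocMass`, which cancels the
normalization of the kernel and leaves the joint law. -/
theorem IsModel.map_restrict_eq_compProd (hD : IsModel p D μ) (q : Option K₁) (i : K₁ ⊕ K₂) :
    (μ.restrict (distAssoc p q D i)).map (fun ω => (D.parentPP q ω, tierDist q D i ω))
      = (μ.restrict (distAssoc p q D i)).map (D.parentPP q) ⊗ₘ servingKernel p i := by
  have hX := hD.measurable_parentPP q
  have hY := hD.measurable_tierDist q i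
  have := Measure.isFiniteMeasure_map (μ.restrict (distAssoc p q D i)) (D.parentPP q)
  refine Measure.ext_prod fun {C B} hC hB => ?_
  have hκB := (servingKernel p i).measurable_coe hB
  rw [Measure.map_apply (hX.prodMk hY) (hC.prod hB), Measure.compProd_apply_prod hC hB,
    Measure.restrict_apply (hX.prodMk hY (hC.prod hB)), hD.map_restrict_distAssoc,
    setLIntegral_withDensity_eq_setLIntegral_mul _ (measurable_assocMass p i) hκB hC,
    setLIntegral_map hC ((measurable_assocMass p i).mul hκB) hX]
  have h1 := hD.measure_parentPP_inter q i hC hB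
  have h2 : (fun ω => (D.parentPP q ω, tierDist q D i ω)) ⁻¹' C ×ˢ B ∩ distAssoc p q D i
      = D.parentPP q ⁻¹' C ∩ (distAssoc p q D i ∩ tierDist q D i ⁻¹' B) := by
    ext ω
    simp only [mem_inter_iff, mem_preimage, mem_prod]
    tauto
  rw [h2, h1]
  refine lintegral_congr_ae (ae_restrict_of_ae ?_)
  filter_upwards [hD.ae_good q] with ω hω
  rw [Pi.mul_apply, servingKernel_apply_set p i _ hB, mul_comm, mul_assoc, parentPP_eq,
    ENNReal.inv_mul_cancel (hω.assocMass_ne_zero i)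
      (ne_top_of_le_ne_top ENNReal.one_ne_top (hD.assocMass_le_one hω i)), mul_one]

theorem IsModel.condDistrib_tierDist (hD : IsModel p D μ) (q : Option K₁) (i : K₁ ⊕ K₂) :
    ∀ᵐ ω ∂μ, condDistrib (tierDist q D i) (D.parentPP q) (μ[|distAssoc p q D i]) (D.parentPP q ω)
      = servingKernel p i (D.parentPP q ω) := by
  have hX := hD.measurable_parentPP q
  have hY := hD.measurable_tierDist q i
  have h1 := condDistrib_ae_eq_of_measure_eq_compProd (μ := μ[|distAssoc p q D i])
    (D.parentPP q) hY.aemeasurable (κ := servingKernel p i) (by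
      rw [ProbabilityTheory.cond, Measure.map_smul, Measure.map_smul, hD.map_restrict_eq_compProd,
        Measure.compProd_smul_left])
  -- Uniqueness of the conditional law holds almost everywhere for the parents' law conditioned on
  -- association. Almost sure positivity of `assocMass` transfers it to the unconditioned law.
  have h2 : μ.map (D.parentPP q) ≪ (μ[|distAssoc p q D i]).map (D.parentPP q) := by
    rw [ProbabilityTheory.cond, Measure.map_smul, hD.map_restrict_distAssoc]
    refine (withDensity_absolutelyContinuous' (measurable_assocMass p i).aemeasurable ?_).trans
      (Measure.absolutelyContinuous_smul (by simp))
    have hS : MeasurableSet {φ | assocMass p i φ ≠ 0} :=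
      (measurable_assocMass p i (measurableSet_singleton 0)).compl
    rw [ae_map_iff hX.aemeasurable hS]
    filter_upwards [hD.ae_good q] with ω hω using hω.assocMass_ne_zero i
  exact ae_of_ae_map hX.aemeasurable (h2.ae_le h1)

end Conditioning

end HetNet

/-! ### From tier distances to the serving base station -/

theorem mainTheorem5 {K₁ K₂ Ω : Type*} [Fintype K₁] [Fintype K₂] [Nonempty (K₁ ⊕ K₂)]
    [MeasurableSpace Ω] (μ : Measure Ω) [IsProbabilityMeasure μ]
    (p : HetNet.Params K₁ K₂) (q : Option K₁) (D : HetNet.Data K₁ K₂ Ω)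
    (hD : HetNet.IsModel p D μ) (i : K₁ ⊕ K₂) :
    -- the conditional association probability is positive and is the integral of its integrand
    (∀ᵐ ω ∂μ, 0 < (μ⟦HetNet.assoc p q D i | D.parentSigma q⟧) ω ∧
      ENNReal.ofReal ((μ⟦HetNet.assoc p q D i | D.parentSigma q⟧) ω)
        = ∫⁻ r in Set.Ici 0, HetNet.assocIntegrand p q D i ω r) ∧
    -- given the association event and the parent processes, the serving distance has as density
    -- the integrand divided by the conditional association probability
    (∀ᵐ ω ∂μ,
      condDistrib (fun ω' => ‖HetNet.serving p q D ω'‖) (D.parentPP q)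
          (μ[|HetNet.assoc p q D i]) (D.parentPP q ω)
        = (volume.restrict (Set.Ici 0)).withDensity fun r =>
            HetNet.assocIntegrand p q D i ω r /
              ENNReal.ofReal ((μ⟦HetNet.assoc p q D i | D.parentSigma q⟧) ω)) := by
  have hA := hD.assoc_ae_eq q i
  have hcE : (fun ω => (HetNet.assocMass p i (D.parentPP q ω)).toReal)
      =ᵐ[μ] μ⟦HetNet.assoc p q D i | D.parentSigma q⟧ :=
    (hD.condExp_distAssoc q i).trans
      (condExp_congr_ae (indicator_ae_eq_of_ae_eq_set hA.symm))
  have hcond : μ[|HetNet.assoc p q D i] = μ[|HetNet.distAssoc p q D i] := by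
    rw [ProbabilityTheory.cond, ProbabilityTheory.cond, measure_congr hA,
      Measure.restrict_congr_set hA]
  -- The serving distance is the distance to tier $i$ only on the association event, hence almost
  -- surely for the conditioned measure.
  have hY : (fun ω' => ‖HetNet.serving p q D ω'‖)
      =ᵐ[μ[|HetNet.distAssoc p q D i]] HetNet.tierDist q D i := by
    rw [Filter.EventuallyEq, ProbabilityTheory.cond]
    refine Measure.ae_smul_measure ?_ _
    rw [ae_restrict_iff' (hD.measurableSet_distAssoc q i)]
    filter_upwards [hD.ae_regular q] with ω hω hmem
    have : HetNet.serving p q D ω = HetNet.candidate q D i ω := (HetNet.mem_assoc_iff hω i).2 hmem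
    rw [this, HetNet.norm_candidate hω]
  refine ⟨?_, ?_⟩
  · filter_upwards [hD.ae_good q, hcE] with ω hω h1
    have hne := hω.assocMass_ne_zero i
    have htop := ne_top_of_le_ne_top ENNReal.one_ne_top (hD.assocMass_le_one hω i)
    rw [← h1]
    refine ⟨ENNReal.toReal_pos hne htop, ?_⟩
    rw [HetNet.parentPP_eq, ENNReal.ofReal_toReal htop]
    exact lintegral_congr_ae ((HetNet.assocIntegrand_ae_eq hω i).mono fun _ h => h.symm)
  · have hcd : condDistrib (fun ω' => ‖HetNet.serving p q D ω'‖) (D.parentPP q)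
          (μ[|HetNet.assoc p q D i])
        = condDistrib (HetNet.tierDist q D i) (D.parentPP q) (μ[|HetNet.distAssoc p q D i]) := by
      rw [← condDistrib_congr_left hY]
      simp only [hcond]
    rw [hcd]
    filter_upwards [hD.ae_good q, hcE, hD.condDistrib_tierDist q i] with ω hω h1 h2
    have htop := ne_top_of_le_ne_top ENNReal.one_ne_top (hD.assocMass_le_one hω i)
    rw [h2, HetNet.servingKernel_apply, ← h1]
    refine withDensity_congr_ae ?_
    filter_upwards [HetNet.assocIntegrand_ae_eq hω i] with r hr
    rw [hr, HetNet.parentPP_eq, ENNReal.ofReal_toReal htop, div_eq_mul_inv]
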